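/- Let $\mathcal J$ denote the set of bounded whole-line Jacobi matrices, that is, of the bounded self-adjoint operators on $\ell^2(\mathbb Z)$ of the form $$(Ju)_n = a_n u_{n+1} + a_{n-1}u_{n-1} + b_n u_n ,\qquad n\in\mathbb Z,$$ where $(a_n)_{n\in\mathbb Z}$, $(b_n)_{n\in\mathbb Z}$ are bounded real sequences with $a_n>0$ for all $n$. For a bounded operator $X$ write $X_{jk}=\langle \delta_j, X\delta_k\rangle$ for its matrix elements with respect to the standard unit vectors, and let $X_a$ be the infinite matrix with $(X_a)_{jk}=X_{jk}$ for $j<k$, $(X_a)_{jk}=-X_{jk}$ for $j>k$, and $(X_a)_{jj}=0$. For $f\in C^2(\mathbb R)$ (real-valued) and $J\in\mathcal J$, let $f(J)$ be defined by the functional calculus, and let $X_f(J)$ be the bounded tridiagonal operator on $\ell^2(\mathbb Z)$ with matrix elements $$X_f(J)_{jk} = \begin{cases} \left( f(J)_a J - J f(J)_a \right)_{jk} & |j-k|\le 1, \\ 0 & \text{otherwise,}\end{cases}$$ where the products are products of infinite matrices (all sums are finite because $J$ is tridiagonal). **Theorem.** Let $f\in C^2(\mathbb R)$. For every $J_0\in\mathcal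 J$ there is exactly one map $J:\mathbb R\to\mathcal J$ such that $J(0)=J_0$ and $J$ is differentiable on $\mathbb R$ with respect to the operator norm with $$\dot J(t) = X_f(J(t)) \qquad\text{for all } t\in\mathbb R .$$ -/

import Mathlib

noncomputable section

namespace GenToda

open scoped ENNReal

/-- The Hilbert space `ℓ²(ℤ)` (with complex scalars): Mathlib's `lp`, with its Hilbert space
structure. (It is a `def` so that its real vector space structure is found only by restriction of
scalars from `ℂ`.) -/
def L2Z : Type := lp (fun _ : ℤ => ℂ) 2

instance : NormedAddCommGroup L2Z := inferInstanceAs (NormedAddCommGroup (lp (fun _ : ℤ => ℂ) 2))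

instance : InnerProductSpace ℂ L2Z := inferInstanceAs (InnerProductSpace ℂ (lp (fun _ : ℤ => ℂ) 2))

instance : CompleteSpace L2Z := inferInstanceAs (CompleteSpace (lp (fun _ : ℤ => ℂ) 2))

instance : CoeFun L2Z (fun _ => ℤ → ℂ) := ⟨fun u => Subtype.val u⟩

theorem L2Z.ext {u v : L2Z} (h : ∀ n, u n = v n) : u = v := lp.ext (funext h)

/-- Bounded operators on `ℓ²(ℤ)`, with the operator norm. -/
abbrev Op : Type := L2Z →L[ℂ] L2Z

/-- The standard unit vector `δ_k`. -/
def delta (k : ℤ) : L2Z := lp.single 2 k (1 : ℂ)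

/-- The matrix elements `X_{jk} = ⟨δ_j, X δ_k⟩` of a bounded operator. -/
def entry (X : Op) (j k : ℤ) : ℂ := inner ℂ (delta j) (X (delta k))

theorem entry_eq (X : Op) (j k : ℤ) : entry X j k = X (delta k) j := by
  have h := lp.inner_single_left (𝕜 := ℂ) (G := fun _ : ℤ => ℂ) j (1 : ℂ) (X (delta k))
  refine Eq.trans h ?_
  simp

theorem delta_apply (k n : ℤ) : delta k n = if n = k then 1 else 0 := by
  have h := lp.single_apply (E := fun _ : ℤ => ℂ) 2 k (1 : ℂ) n
  refine h.trans ?_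
  simp [Pi.single_apply]

theorem norm_entry_le (X : Op) (j k : ℤ) : ‖entry X j k‖ ≤ ‖X‖ := by
  have hd : ∀ i : ℤ, ‖delta i‖ = 1 := fun i => by
    have h := lp.norm_single (E := fun _ : ℤ => ℂ) (p := 2) (by norm_num) i (1 : ℂ)
    exact h.trans norm_one
  calc ‖entry X j k‖ ≤ ‖delta j‖ * ‖X (delta k)‖ := norm_inner_le_norm _ _
    _ ≤ 1 * (‖X‖ * 1) := by
      rw [hd j]
      gcongr
      simpa [hd k] using X.le_opNorm (delta k)
    _ = ‖X‖ := by ring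

/-- A sequence all of whose weighted translates `n ↦ c n * u (n + m)` are controlled: these are
square summable when `c` is bounded and `u ∈ ℓ²(ℤ)`. -/
theorem memlp_mul_shift {c : ℤ → ℂ} {C : ℝ} (hC : ∀ n, ‖c n‖ ≤ C) (m : ℤ) (u : L2Z) :
    Memℓp (fun n : ℤ => c n * u (n + m)) 2 := by
  have hu : Summable fun n : ℤ => ‖u n‖ ^ 2 := by
    have := (memℓp_gen_iff (p := 2) (by norm_num)).1 (lp.memℓp (E := fun _ : ℤ => ℂ) (p := 2) u)
    simpa using this
  have hs : Summable fun n : ℤ => ‖u (n + m)‖ ^ 2 :=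
    (Equiv.addRight m).summable_iff.2 hu
  refine (memℓp_gen_iff (p := 2) (by norm_num)).2 ?_
  have : Summable fun n : ℤ => ‖c n * u (n + m)‖ ^ 2 := by
    refine Summable.of_nonneg_of_le (fun n => by positivity) (fun n => ?_) (hs.mul_left (C ^ 2))
    rw [norm_mul, mul_pow]
    gcongr
    exact hC n
  simpa using this

theorem norm_mul_shift_le {c : ℤ → ℂ} {C : ℝ} (hC : ∀ n, ‖c n‖ ≤ C) (m : ℤ) (u : L2Z) :
    ‖(⟨fun n : ℤ => c n * u (n + m), memlp_mul_shift hC m u⟩ : L2Z)‖ ≤ C * ‖u‖ := by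
  have hC0 : 0 ≤ C := (norm_nonneg _).trans (hC 0)
  have hu : HasSum (fun n : ℤ => ‖u n‖ ^ 2) (‖u‖ ^ 2) := by
    have h := lp.hasSum_norm (E := fun _ : ℤ => ℂ) (p := 2) (by norm_num) u
    simp only [ENNReal.toReal_ofNat, Real.rpow_ofNat] at h
    exact h
  have hs : HasSum (fun n : ℤ => ‖u (n + m)‖ ^ 2) (‖u‖ ^ 2) :=
    (Equiv.addRight m).hasSum_iff.2 hu
  have hv := lp.hasSum_norm (E := fun _ : ℤ => ℂ) (p := 2) (by norm_num)
    (⟨fun n : ℤ => c n * u (n + m), memlp_mul_shift hC m u⟩ : L2Z)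
  have hv' : HasSum (fun n : ℤ => ‖c n * u (n + m)‖ ^ 2)
      (‖(⟨fun n : ℤ => c n * u (n + m), memlp_mul_shift hC m u⟩ : L2Z)‖ ^ 2) := by
    simpa using hv
  have hle := hasSum_le (fun n => ?_) hv' (hs.mul_left (C ^ 2))
  · rw [← mul_pow] at hle
    exact le_of_sq_le_sq hle (by positivity)
  · rw [norm_mul, mul_pow]
    gcongr
    exact hC n

/-- The bounded operator `(T u)_n = c_n u_{n+m}` for a bounded sequence `c`. -/
def weightedShift (c : ℤ → ℂ) (m : ℤ) (hc : ∃ C : ℝ, ∀ n, ‖c n‖ ≤ C) : Op :=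
  LinearMap.mkContinuous
    { toFun := fun u => ⟨fun n : ℤ => c n * u (n + m), memlp_mul_shift hc.choose_spec m u⟩
      map_add' := fun u v => by
        refine L2Z.ext fun n => ?_
        exact mul_add (c n) (u (n + m)) (v (n + m))
      map_smul' := fun z u => by
        refine L2Z.ext fun n => ?_
        exact mul_left_comm (c n) z (u (n + m)) }
    hc.choose (fun u => norm_mul_shift_le hc.choose_spec m u)

theorem weightedShift_apply (c : ℤ → ℂ) (m : ℤ) (hc : ∃ C : ℝ, ∀ n, ‖c n‖ ≤ C) (u : L2Z)
    (n : ℤ) : weightedShift c m hc u n = c n * u (n + m) := rfl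

/-- The bounded operator whose matrix agrees with a bounded matrix `M` on the three central
diagonals `|j - k| ≤ 1` and is zero elsewhere. -/
def tridiagOp (M : ℤ → ℤ → ℂ) (hM : ∃ C : ℝ, ∀ j k, ‖M j k‖ ≤ C) : Op :=
  weightedShift (fun n => M n (n + 1)) 1 (hM.imp fun _ h n => h n (n + 1)) +
  weightedShift (fun n => M n (n - 1)) (-1) (hM.imp fun _ h n => h n (n - 1)) +
  weightedShift (fun n => M n n) 0 (hM.imp fun _ h n => h n n)

theorem tridiagOp_apply (M : ℤ → ℤ → ℂ) (hM : ∃ C : ℝ, ∀ j k, ‖M j k‖ ≤ C) (u : L2Z) (n : ℤ) :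
    tridiagOp M hM u n = M n (n + 1) * u (n + 1) + M n (n - 1) * u (n - 1) + M n n * u n := by
  have h : tridiagOp M hM u n =
      M n (n + 1) * u (n + 1) + M n (n - 1) * u (n + -1) + M n n * u (n + 0) := rfl
  rw [h, add_zero, ← sub_eq_add_neg]

theorem entry_tridiagOp (M : ℤ → ℤ → ℂ) (hM : ∃ C : ℝ, ∀ j k, ‖M j k‖ ≤ C) (j k : ℤ) :
    entry (tridiagOp M hM) j k = if |j - k| ≤ 1 then M j k else 0 := by
  rw [entry_eq, tridiagOp_apply]
  simp only [delta_apply]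
  by_cases h1 : j + 1 = k
  · subst h1
    simp [show ¬ (j - 1 = j + 1) by omega]
  by_cases h2 : j - 1 = k
  · subst h2
    simp [show ¬ (j + 1 = j - 1) by omega, show ¬ (j = j - 1) by omega]
  by_cases h3 : j = k
  · subst h3
    simp
  · have : ¬ |j - k| ≤ 1 := by
      rw [abs_le]
      omega
    simp [h1, h2, h3, this]

/-- A (bounded, whole line) Jacobi matrix, given by its coefficients: bounded real sequences
`a_n > 0`, `b_n`. -/
@[ext]
structure JacobiMatrix where
  a : ℤ → ℝ
  b : ℤ → ℝ
  a_pos : ∀ n, 0 < a n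
  a_bdd : ∃ C : ℝ, ∀ n, |a n| ≤ C
  b_bdd : ∃ C : ℝ, ∀ n, |b n| ≤ C

namespace JacobiMatrix

/-- The infinite tridiagonal matrix of a Jacobi matrix. -/
def mat (J : JacobiMatrix) (j k : ℤ) : ℂ :=
  if k = j + 1 then (J.a j : ℂ) else if j = k + 1 then (J.a k : ℂ)
  else if j = k then (J.b j : ℂ) else 0

theorem mat_bdd (J : JacobiMatrix) : ∃ C : ℝ, ∀ j k, ‖J.mat j k‖ ≤ C := by
  obtain ⟨A, hA⟩ := J.a_bdd
  obtain ⟨B, hB⟩ := J.b_bdd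
  have hA0 : 0 ≤ A := (abs_nonneg _).trans (hA 0)
  have hB0 : 0 ≤ B := (abs_nonneg _).trans (hB 0)
  refine ⟨A + B, fun j k => ?_⟩
  unfold mat
  split_ifs
  · simpa using (hA j).trans (by linarith)
  · simpa using (hA k).trans (by linarith)
  · simpa using (hB j).trans (by linarith)
  · simpa using add_nonneg hA0 hB0

/-- The bounded operator on `ℓ²(ℤ)` defined by a Jacobi matrix. -/
def op (J : JacobiMatrix) : Op := tridiagOp J.mat J.mat_bdd

/-- `(J u)_n = a_n u_{n+1} + a_{n-1} u_{n-1} + b_n u_n`. -/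
theorem op_apply (J : JacobiMatrix) (u : L2Z) (n : ℤ) :
    J.op u n = J.a n * u (n + 1) + J.a (n - 1) * u (n - 1) + J.b n * u n := by
  rw [op, tridiagOp_apply]
  simp [mat, show ¬ (n - 1 = n + 1) by omega]

theorem entry_op (J : JacobiMatrix) (j k : ℤ) : entry J.op j k = J.mat j k := by
  rw [op, entry_tridiagOp]
  split_ifs with h
  · rfl
  · rw [abs_le] at h
    unfold mat
    rw [if_neg (by omega), if_neg (by omega), if_neg (by omega)]

/-- The operator of a Jacobi matrix is self-adjoint. -/
theorem isSelfAdjoint_op (J : JacobiMatrix) : IsSelfAdjoint J.op := by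
  have hmat : ∀ j k, J.mat j k = (starRingEnd ℂ) (J.mat k j) := fun j k => by
    unfold mat
    by_cases h1 : k = j + 1
    · rw [if_pos h1, if_neg (by omega), if_pos h1, Complex.conj_ofReal]
    by_cases h2 : j = k + 1
    · rw [if_neg h1, if_pos h2, if_pos h2, Complex.conj_ofReal]
    by_cases h3 : j = k
    · subst h3
      simp
    · rw [if_neg h1, if_neg h2, if_neg h3, if_neg h2, if_neg h1, if_neg (Ne.symm h3), map_zero]
  have happ : ∀ (X : Op) (j k : ℤ), X (delta k) j = inner ℂ (delta j) (X (delta k)) :=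
    fun X j k => (entry_eq X j k).symm
  have hkey : ∀ k, ContinuousLinearMap.adjoint J.op (delta k) = J.op (delta k) := fun k => by
    refine L2Z.ext fun j => ?_
    rw [happ, happ, ContinuousLinearMap.adjoint_inner_right, ← inner_conj_symm]
    change (starRingEnd ℂ) (entry J.op k j) = entry J.op j k
    rw [entry_op, entry_op, ← hmat]
  refine ContinuousLinearMap.ext fun u => ?_
  have hu : HasSum (fun k : ℤ => (u k) • delta k) u := by
    have h := lp.hasSum_single (E := fun _ : ℤ => ℂ) (p := 2) (by norm_num) u
    refine HasSum.congr_fun (f := fun k : ℤ => (lp.single 2 k (u k) : L2Z)) h ?_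
    intro k
    have := lp.single_smul (E := fun _ : ℤ => ℂ) 2 k (u k) (1 : ℂ)
    rw [smul_eq_mul, mul_one] at this
    exact this.symm
  have e1 := (ContinuousLinearMap.adjoint J.op).hasSum hu
  have e2 := J.op.hasSum hu
  simp only [map_smul, hkey] at e1 e2
  exact e1.unique e2

/-- A Jacobi matrix is determined by its operator. -/
theorem op_injective : Function.Injective op := fun J K h => by
  have hjk : ∀ j k, J.mat j k = K.mat j k := fun j k => by rw [← entry_op, ← entry_op, h]
  ext n
  · simpa [mat] using hjk n (n + 1)
  · simpa [mat] using hjk n n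

end JacobiMatrix

/-- The anti-symmetric part of (the matrix of) an operator `X`: `(X_a)_{jk} = X_{jk}` for `j < k`,
`(X_a)_{jk} = -X_{jk}` for `j > k`, `(X_a)_{jj} = 0`. It is only a matrix, and need not define a
bounded operator. -/
def antisymmPart (X : Op) (j k : ℤ) : ℂ :=
  if j < k then entry X j k else if k < j then -entry X j k else 0

/-- Row times column product of infinite matrices. It is only used when one of the factors is
tridiagonal, and then the sum has at most three nonzero terms. -/
def matMul (A B : ℤ → ℤ → ℂ) (j k : ℤ) : ℂ := ∑' m : ℤ, A j m * B m k

/-- The matrix `[f(J)_a, J] = f(J)_a J - J f(J)_a`; here `f(J)` is given by the continuous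
functional calculus of the self-adjoint operator `J`. -/
def laxCommutator (f : ℝ → ℝ) (J : JacobiMatrix) (j k : ℤ) : ℂ :=
  matMul (antisymmPart (cfc f J.op)) (entry J.op) j k -
    matMul (entry J.op) (antisymmPart (cfc f J.op)) j k

theorem norm_antisymmPart_le (X : Op) (j k : ℤ) : ‖antisymmPart X j k‖ ≤ ‖X‖ := by
  unfold antisymmPart
  split_ifs
  · exact norm_entry_le X j k
  · simpa using norm_entry_le X j k
  · simp

theorem norm_tsum_near_le (g : ℤ → ℂ) (k : ℤ) (D : ℝ) (hg : ∀ m, ‖g m‖ ≤ D)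
    (h0 : ∀ m, ¬ |m - k| ≤ 1 → g m = 0) : ‖∑' m : ℤ, g m‖ ≤ 3 * D := by
  rw [tsum_eq_sum (s := Finset.Icc (k - 1) (k + 1))
    (fun m hm => h0 m (by rw [Finset.mem_Icc] at hm; rw [abs_le]; omega))]
  refine (norm_sum_le_of_le _ fun m _ => hg m).trans ?_
  have : (k + 1 + 1 - (k - 1)).toNat = 3 := by omega
  simp [this]

theorem laxCommutator_bdd (f : ℝ → ℝ) (J : JacobiMatrix) :
    ∃ C : ℝ, ∀ j k, ‖laxCommutator f J j k‖ ≤ C := by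
  have h0 : ∀ j k : ℤ, ¬ |j - k| ≤ 1 → entry J.op j k = 0 := fun j k h => by
    rw [JacobiMatrix.op, entry_tridiagOp, if_neg h]
  refine ⟨3 * (‖cfc f J.op‖ * ‖J.op‖) + 3 * (‖J.op‖ * ‖cfc f J.op‖), fun j k => ?_⟩
  refine (norm_sub_le _ _).trans (add_le_add ?_ ?_)
  · refine norm_tsum_near_le _ k _ (fun m => ?_) (fun m hm => ?_)
    · rw [norm_mul]
      gcongr
      exacts [norm_antisymmPart_le _ _ _, norm_entry_le _ _ _]
    · rw [h0 m k hm, mul_zero]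
  · refine norm_tsum_near_le _ j _ (fun m => ?_) (fun m hm => ?_)
    · rw [norm_mul]
      gcongr
      exacts [norm_entry_le _ _ _, norm_antisymmPart_le _ _ _]
    · rw [h0 j m (by rwa [abs_sub_comm]), zero_mul]

/-- The bounded operator `X_f(J)`: the tridiagonal truncation of `[f(J)_a, J]`. -/
def laxField (f : ℝ → ℝ) (J : JacobiMatrix) : Op :=
  tridiagOp (laxCommutator f J) (laxCommutator_bdd f J)

theorem entry_laxField (f : ℝ → ℝ) (J : JacobiMatrix) (j k : ℤ) :
    entry (laxField f J) j k = if |j - k| ≤ 1 then laxCommutator f J j k else 0 :=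
  entry_tridiagOp _ _ _ _

/-- `J : ℝ → 𝒥` is a global solution of `J̇ = X_f(J)`; the derivative is the limit of the
difference quotients in operator norm. -/
def IsGlobalSolution (f : ℝ → ℝ) (J : ℝ → JacobiMatrix) : Prop :=
  ∀ t : ℝ, HasDerivAt (fun s : ℝ => (J s).op) (laxField f (J t)) t

end GenToda

end

/-!
The operator `X_f(J)` is again real symmetric and tridiagonal. Writing `F = f(J)`, the relation
`F J = J F` turns the differential equation into
`ȧₙ = aₙ (Fₙ₊₁,ₙ₊₁ - Fₙₙ)`, `ḃₙ = 2 (aₙ Fₙ,ₙ₊₁ - aₙ₋₁ Fₙ₋₁,ₙ)`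
(`antisymm_commutator_eq`, `laxField_eq_jacOp`), an ordinary differential equation in the Banach
space `Coeff` of pairs of bounded real sequences, whose right-hand side is bilinear in the
coefficients and in `F`. The operator norm of `J` and the norm of its coefficients are equivalent.

*Local theory.* The vector field is Lipschitz on bounded sets because a `C²` function is operator
Lipschitz on bounded sets (`exists_norm_cfc_sub_le`): cut off and expanded in a Fourier series,
`f(x) = ∑ cₙ e^{inωx}` with `∑ |n| |cₙ| < ∞`, and `‖e^{itA} - e^{itB}‖ ≤ |t| ‖A - B‖`.

*Global existence.* Formally `J̇ = [B, J]` with `B = f(J)_a` skew-adjoint, so that the norm of `J`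
is conserved; but `f(J)_a` need not be bounded. For a polynomial `p` the matrix `p(J)` is banded, so
`p(J)_a` is bounded, and approximating `f` uniformly by polynomials shows that `X_f(J)` is a norm
limit of commutators `[B, J]` with `B` bounded and skew-adjoint (`exists_skew_commutator_approx`).
This is already enough: `(1 + hB) J (1 - hB) = J + h[B, J] + O(h²)` and `‖1 ± hB‖ = 1 + O(h²)`, so
the upper right derivative of `‖J(t)‖` is at most `ε` for every `ε > 0`
(`norm_le_of_skew_commutator_approx`). The same holds after time reversal, and after a time change,
in particular when the vector field is cut off outside a ball. The cut-off field is bounded and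
Lipschitz, hence has global solutions, and these never leave the ball on which the cut-off is `1`
(`exists_solution_todaField`).

*Uniqueness and positivity.* Norm conservation also confines any solution to a ball on which the
field is Lipschitz, which gives uniqueness. Each `aₙ` solves a scalar linear equation with bounded
coefficient, so it stays positive.
-/

/-! ### Operator Lipschitz estimates for `C²` functions -/

theorem norm_le_norm_of_mem_spectrum {𝕜 A : Type*} [NormedField 𝕜] [CStarAlgebra A]
    [NormedAlgebra 𝕜 A] {a : A} {z : 𝕜} (hz : z ∈ spectrum 𝕜 a) : ‖z‖ ≤ ‖a‖ := by
  rcases subsingleton_or_nontrivial A with h | h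
  · simp at hz
  · exact spectrum.norm_le_norm_of_mem hz

open Complex in
theorem norm_cfc_exp_mul_I_le {A : Type*} [CStarAlgebra A] {a : A} (ha : IsSelfAdjoint a) (t : ℝ) :
    ‖cfc (fun z : ℂ => exp (t * I * z)) a‖ ≤ 1 := by
  refine norm_cfc_le zero_le_one fun z hz => ?_
  have hz' : z = (z.re : ℂ) := ha.mem_spectrum_eq_re hz
  rw [hz', mul_right_comm, ← ofReal_mul, norm_exp_ofReal_mul_I]

open Complex in
theorem cfc_exp_mul_I_eq {A : Type*} [CStarAlgebra A] {a : A} (ha : IsSelfAdjoint a) (t : ℝ) :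
    cfc (fun z : ℂ => exp (t * I * z)) a = NormedSpace.exp (t • (I • a)) := by
  have hn : IsStarNormal a := ha.isStarNormal
  rw [cfc_comp' exp (fun z : ℂ => t * I * z) a, cfc_const_mul_id _ a]
  rw [CFC.complex_exp_eq_normedSpace_exp, mul_smul, Complex.coe_smul]

open Complex in
/-- Duhamel's formula: `e^{itA} - e^{itB} = ∫₀ᵗ e^{isA} i(A - B) e^{i(t-s)B} ds`, in the form of a
mean value estimate. -/
theorem norm_exp_mul_I_sub_le {A : Type*} [CStarAlgebra A] {a b : A} (ha : IsSelfAdjoint a)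
    (hb : IsSelfAdjoint b) (t : ℝ) :
    ‖cfc (fun z : ℂ => exp (t * I * z)) a - cfc (fun z : ℂ => exp (t * I * z)) b‖
      ≤ |t| * ‖a - b‖ := by
  have hexp : ∀ {c : A}, IsSelfAdjoint c → ∀ s : ℝ, ‖NormedSpace.exp (s • (I • c))‖ ≤ 1 :=
    fun hc s => by
      rw [← cfc_exp_mul_I_eq hc]
      exact norm_cfc_exp_mul_I_le hc s
  have hder : ∀ s : ℝ, HasDerivAt
      (fun s : ℝ => NormedSpace.exp (s • (I • a)) * NormedSpace.exp ((t - s) • (I • b)))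
      (NormedSpace.exp (s • (I • a)) * (I • (a - b)) * NormedSpace.exp ((t - s) • (I • b))) s := by
    intro s
    have h1 := hasDerivAt_exp_smul_const (𝕂 := ℝ) (I • a) s
    have h2 := (hasDerivAt_exp_smul_const' (𝕂 := ℝ) (I • b) (t - s)).scomp s
      ((hasDerivAt_id s).const_sub t)
    refine (h1.mul h2).congr_deriv ?_
    simp only [smul_sub, mul_sub, sub_mul, neg_smul, one_smul, mul_neg, Function.comp_apply,
      mul_assoc, ← sub_eq_add_neg]
  have hbound : ∀ s : ℝ, ‖NormedSpace.exp (s • (I • a)) * (I • (a - b)) *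
      NormedSpace.exp ((t - s) • (I • b))‖ ≤ ‖a - b‖ := by
    intro s
    calc _ ≤ ‖NormedSpace.exp (s • (I • a))‖ * ‖I • (a - b)‖ *
          ‖NormedSpace.exp ((t - s) • (I • b))‖ :=
        (norm_mul_le _ _).trans (mul_le_mul_of_nonneg_right (norm_mul_le _ _) (norm_nonneg _))
      _ ≤ 1 * ‖I • (a - b)‖ * 1 := by
        gcongr
        exacts [hexp ha s, hexp hb _]
      _ = ‖a - b‖ := by simp [norm_smul]
  have := convex_univ.norm_image_sub_le_of_norm_hasDerivWithin_le (𝕜 := ℝ)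
    (fun s _ => (hder s).hasDerivWithinAt) (fun s _ => hbound s) (Set.mem_univ 0) (Set.mem_univ t)
  rw [cfc_exp_mul_I_eq ha, cfc_exp_mul_I_eq hb]
  simpa [mul_comm] using this

/-- A function which is approximated uniformly on `[-R, R]` by trigonometric sums
`∑ cₖ e^{i wₖ x}` with bounded `∑ |cₖ| |wₖ|` is operator Lipschitz on the ball of radius `R`. -/
theorem norm_cfc_sub_le_of_trig_approx {A : Type*} [CStarAlgebra A] {f : ℝ → ℝ}
    {R C : ℝ} (hf : Continuous f)
    (happ : ∀ ε > 0, ∃ (s : Finset ℤ) (c : ℤ → ℂ) (w : ℤ → ℝ),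
      (∀ x : ℝ, |x| ≤ R → ‖(f x : ℂ) - ∑ n ∈ s, c n * Complex.exp (w n * Complex.I * x)‖ ≤ ε) ∧
      ∑ n ∈ s, ‖c n‖ * |w n| ≤ C)
    {a b : A} (ha : IsSelfAdjoint a) (hb : IsSelfAdjoint b) (haR : ‖a‖ ≤ R) (hbR : ‖b‖ ≤ R) :
    ‖cfc f a - cfc f b‖ ≤ C * ‖a - b‖ := by
  refine le_of_forall_pos_le_add fun ε hε => ?_
  obtain ⟨s, c, w, hs, hC⟩ := happ (ε / 2) (by positivity)
  have key : ∀ {d : A}, IsSelfAdjoint d → ‖d‖ ≤ R →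
      ‖cfc f d - ∑ n ∈ s, c n • cfc (fun z : ℂ => Complex.exp (w n * Complex.I * z)) d‖ ≤ ε / 2 := by
    intro d hd hdR
    have hn : IsStarNormal d := hd.isStarNormal
    have e1 : ∑ n ∈ s, c n • cfc (fun z : ℂ => Complex.exp (w n * Complex.I * z)) d =
        cfc (fun z : ℂ => ∑ n ∈ s, c n * Complex.exp (w n * Complex.I * z)) d := by
      have h := cfc_sum (fun (n : ℤ) (z : ℂ) => c n * Complex.exp (w n * Complex.I * z)) d s
        (fun n _ => by fun_prop)
      rw [Finset.sum_fn] at h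
      rw [h]
      refine Finset.sum_congr rfl fun n _ => ?_
      rw [cfc_const_mul (c n) (fun z : ℂ => Complex.exp (w n * Complex.I * z)) d]
    rw [e1, cfc_real_eq_complex f hd, ← cfc_sub (fun z : ℂ => (f z.re : ℂ))
      (fun z : ℂ => ∑ n ∈ s, c n * Complex.exp (w n * Complex.I * z)) d
      (by fun_prop) (by fun_prop)]
    refine norm_cfc_le (by positivity) fun z hz => ?_
    have hz' : z = (z.re : ℂ) := hd.mem_spectrum_eq_re hz
    have hzR : |z.re| ≤ R :=
      (Complex.abs_re_le_norm z).trans ((norm_le_norm_of_mem_spectrum hz).trans hdR)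
    have := hs z.re hzR
    rwa [← hz'] at this
  calc ‖cfc f a - cfc f b‖
      = ‖(cfc f a - ∑ n ∈ s, c n • cfc (fun z : ℂ => Complex.exp (w n * Complex.I * z)) a)
        - (cfc f b - ∑ n ∈ s, c n • cfc (fun z : ℂ => Complex.exp (w n * Complex.I * z)) b)
        + ∑ n ∈ s, c n • (cfc (fun z : ℂ => Complex.exp (w n * Complex.I * z)) a -
            cfc (fun z : ℂ => Complex.exp (w n * Complex.I * z)) b)‖ := by
        congr 1
        simp only [smul_sub, Finset.sum_sub_distrib]
        abel
    _ ≤ ε / 2 + ε / 2 + ∑ n ∈ s, ‖c n‖ * |w n| * ‖a - b‖ := by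
        refine (norm_add_le _ _).trans (add_le_add ((norm_sub_le _ _).trans
          (add_le_add (key ha haR) (key hb hbR))) ((norm_sum_le _ _).trans
          (Finset.sum_le_sum fun n _ => ?_)))
        rw [norm_smul, mul_assoc]
        gcongr
        exact norm_exp_mul_I_sub_le ha hb (w n)
    _ ≤ C * ‖a - b‖ + ε := by
        rw [← Finset.sum_mul]
        nlinarith [norm_nonneg (a - b)]

section Fourier

open Real MeasureTheory

/-- Two integrations by parts give `|n| |ĝ(n)| = C |(g'')^(n)| / |n|`, which is summable by Parseval's
identity for `g''` and the inequality `2 u v ≤ u² + v²`. -/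
theorem summable_abs_mul_norm_fourierCoeffOn {a b : ℝ} (hab : a < b) {g g' g'' : ℝ → ℂ}
    (hg : ∀ x, HasDerivAt g (g' x) x) (hg' : ∀ x, HasDerivAt g' (g'' x) x) (hc : Continuous g'')
    (h0 : g b = g a) (h1 : g' b = g' a) :
    Summable fun n : ℤ => |(n : ℝ)| * ‖fourierCoeffOn hab g n‖ := by
  have hsq : Summable fun n : ℤ => ‖fourierCoeffOn hab g'' n‖ ^ 2 := by
    refine (hasSum_sq_fourierCoeffOn hab ?_).summable
    obtain ⟨M, hM⟩ := isCompact_Icc.exists_bound_of_continuousOn hc.continuousOn (s := Set.Icc a b)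
    exact MemLp.of_bound hc.aestronglyMeasurable M (ae_restrict_of_forall_mem measurableSet_Ioc
      fun x hx => hM x (Set.Ioc_subset_Icc_self hx))
  have hinv : Summable fun n : ℤ => 1 / |(n : ℝ)| ^ 2 := by
    have := (Real.summable_one_div_int_pow (p := 2)).2 (by norm_num)
    simpa using this
  have hC : ∀ n : ℤ, n ≠ 0 → ‖fourierCoeffOn hab g n‖ =
      ((b - a) / (2 * π)) ^ 2 / |(n : ℝ)| ^ 2 * ‖fourierCoeffOn hab g'' n‖ := by
    intro n hn
    have hab' : ‖((b : ℂ) - a)‖ = b - a := by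
      rw [← Complex.ofReal_sub, Complex.norm_real, Real.norm_of_nonneg (by linarith)]
    rw [fourierCoeffOn_of_hasDerivAt hab hn (fun x _ => hg x)
        ((continuous_iff_continuousAt.2 fun x => (hg' x).continuousAt).intervalIntegrable _ _),
      fourierCoeffOn_of_hasDerivAt hab hn (fun x _ => hg' x) (hc.intervalIntegrable _ _), h0, h1]
    simp only [sub_self, mul_zero, zero_sub, norm_mul, norm_neg, norm_div, norm_one, Complex.norm_I,
      Complex.norm_real, Complex.norm_intCast, hab', mul_one, RCLike.norm_ofNat,
      Real.norm_of_nonneg pi_pos.le]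
    ring
  refine Summable.of_nonneg_of_le (fun n => by positivity) (fun n => ?_)
    ((hinv.add hsq).mul_left (((b - a) / (2 * π)) ^ 2))
  rcases eq_or_ne n 0 with rfl | hn
  · simp; positivity
  · rw [hC n hn]
    have hn' : 0 < |(n : ℝ)| := by positivity
    set y := ‖fourierCoeffOn hab g'' n‖
    have : |(n : ℝ)| * (((b - a) / (2 * π)) ^ 2 / |(n : ℝ)| ^ 2 * y) =
        ((b - a) / (2 * π)) ^ 2 * (1 / |(n : ℝ)| * y) := by
      field_simp
    rw [this]
    gcongr
    have h2 : 1 / |(n : ℝ)| ^ 2 = (1 / |(n : ℝ)|) ^ 2 := by ring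
    rw [h2]
    nlinarith [sq_nonneg (1 / |(n : ℝ)| - y), sq_nonneg (1 / |(n : ℝ)|), sq_nonneg y]

/-- A `C²` function is, on a compact interval, a uniform limit of trigonometric sums
`∑ cₙ e^{i wₙ x}` with bounded `∑ |cₙ| |wₙ|`: partial sums of the Fourier series of a cut-off of
the function. -/
theorem exists_trig_approx {f : ℝ → ℝ} (hf : ContDiff ℝ 2 f) {R : ℝ} (hR : 0 ≤ R) :
    ∃ C : ℝ, ∀ ε > 0, ∃ (s : Finset ℤ) (c : ℤ → ℂ) (w : ℤ → ℝ),
      (∀ x : ℝ, |x| ≤ R → ‖(f x : ℂ) - ∑ n ∈ s, c n * Complex.exp (w n * Complex.I * x)‖ ≤ ε) ∧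
      ∑ n ∈ s, ‖c n‖ * |w n| ≤ C := by
  let χ : ContDiffBump (0 : ℝ) := ⟨R + 1, R + 2, by linarith, by linarith⟩
  let g : ℝ → ℝ := fun x => χ x * f x
  have hg2 : ContDiff ℝ 2 g := (χ.contDiff).mul hf
  have hg1 : ContDiff ℝ 1 (deriv g) := hg2.deriv'
  have hgf : ∀ x, |x| ≤ R → g x = f x := fun x hx => by
    have : χ x = 1 := χ.one_of_mem_closedBall (by
      rw [Metric.mem_closedBall, dist_zero_right, Real.norm_eq_abs]
      show |x| ≤ R + 1
      linarith)
    simp [g, this]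
  have hg0 : ∀ x, R + 2 ≤ |x| → g x = 0 := fun x hx => by
    have : χ x = 0 := χ.zero_of_le_dist (by simpa using hx)
    simp [g, this]
  have hg0' : ∀ x, R + 3 ≤ |x| → deriv g x = 0 := fun x hx => by
    have : g =ᶠ[nhds x] fun _ => 0 := by
      filter_upwards [(isOpen_lt continuous_const continuous_abs).mem_nhds
        (show R + 2 < |x| by linarith)] with y hy
      exact hg0 y (le_of_lt hy)
    rw [this.deriv_eq, deriv_const]
  have hRabs : |R + 3| = R + 3 := abs_of_nonneg (by linarith)
  have hab : -(R + 3) < -(R + 3) + 2 * (R + 3) := by linarith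
  have hb : -(R + 3) + 2 * (R + 3) = R + 3 := by ring
  have : Fact (0 < 2 * (R + 3)) := ⟨by linarith⟩
  have hsum : Summable fun n : ℤ => |(n : ℝ)| * ‖fourierCoeffOn hab (fun x => (g x : ℂ)) n‖ := by
    refine summable_abs_mul_norm_fourierCoeffOn hab (g' := fun x => ((deriv g x : ℝ) : ℂ))
      (g'' := fun x => ((deriv (deriv g) x : ℝ) : ℂ)) (fun x => ?_) (fun x => ?_) ?_ ?_ ?_
    · exact ((hg2.differentiable (by norm_num)) x).hasDerivAt.ofReal_comp
    · exact ((hg1.differentiable (by norm_num)) x).hasDerivAt.ofReal_comp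
    · exact Complex.continuous_ofReal.comp (hg1.continuous_deriv le_rfl)
    · simp only [hb]
      rw [hg0 (R + 3) (by linarith), hg0 (-(R + 3)) (by rw [abs_neg]; linarith)]
    · simp only [hb]
      rw [hg0' (R + 3) (by linarith), hg0' (-(R + 3)) (by rw [abs_neg]; linarith)]
  let G : C(AddCircle (2 * (R + 3)), ℂ) :=
    ⟨AddCircle.liftIoc (2 * (R + 3)) (-(R + 3)) (fun x => (g x : ℂ)),
      AddCircle.liftIoc_continuous (by
        rw [hb, hg0 (R + 3) (by linarith), hg0 (-(R + 3)) (by rw [abs_neg]; linarith)])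
        (Complex.continuous_ofReal.comp hg2.continuous).continuousOn⟩
  have hcoef : ∀ n, fourierCoeff G n = fourierCoeffOn hab (fun x => (g x : ℂ)) n := fun n =>
    fourierCoeff_liftIoc_eq _ n
  have hsum' : Summable fun n : ℤ => |(n : ℝ)| * ‖fourierCoeff G n‖ := by
    simpa only [hcoef] using hsum
  have hS : Summable (fourierCoeff G) := by
    refine Summable.of_norm_bounded_eventually hsum' ?_
    rw [Filter.eventually_cofinite]
    refine (Set.finite_singleton (0 : ℤ)).subset fun n hn => ?_
    by_contra h0
    refine hn ?_
    have h1 : (1 : ℝ) ≤ |(n : ℝ)| := by exact_mod_cast Int.one_le_abs h0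
    nlinarith [norm_nonneg (fourierCoeff G n)]
  have hF := hasSum_fourier_series_of_summable hS
  refine ⟨π / (R + 3) * ∑' n : ℤ, |(n : ℝ)| * ‖fourierCoeff G n‖, fun ε hε => ?_⟩
  obtain ⟨s, hs⟩ := (Metric.tendsto_atTop.1 hF) ε hε
  refine ⟨s, fourierCoeff G, fun n => n * (π / (R + 3)), fun x hx => ?_, ?_⟩
  · have h1 := hs s le_rfl
    rw [dist_comm, dist_eq_norm] at h1
    have h2 := ((G - ∑ n ∈ s, fourierCoeff G n • fourier n).norm_coe_le_norm (x : AddCircle _)).trans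
      h1.le
    have hGx : G (x : AddCircle (2 * (R + 3))) = f x := by
      have hx' := abs_le.1 hx
      have : G (x : AddCircle (2 * (R + 3))) = (g x : ℂ) :=
        AddCircle.liftIoc_coe_apply (f := fun x => (g x : ℂ)) ⟨by linarith, by linarith⟩
      rw [this, hgf x hx]
    have h3 : (∑ n ∈ s, fourierCoeff G n • (fourier n : C(AddCircle (2 * (R + 3)), ℂ)))
        (x : AddCircle (2 * (R + 3))) =
        ∑ n ∈ s, fourierCoeff G n * Complex.exp (((n * (π / (R + 3)) : ℝ) : ℂ) * Complex.I * x) := by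
      rw [ContinuousMap.sum_apply]
      refine Finset.sum_congr rfl fun n _ => ?_
      rw [ContinuousMap.smul_apply, fourier_coe_apply, smul_eq_mul]
      congr 2
      have : (R : ℂ) + 3 ≠ 0 := by
        have : (R : ℝ) + 3 ≠ 0 := by linarith
        exact_mod_cast this
      push_cast
      field_simp
    rw [ContinuousMap.sub_apply, h3, hGx] at h2
    exact h2
  · have h3 : ∀ n : ℤ, ‖fourierCoeff G n‖ * |n * (π / (R + 3))| =
        π / (R + 3) * (|(n : ℝ)| * ‖fourierCoeff G n‖) := fun n => by
      rw [abs_mul, abs_of_nonneg (by positivity : 0 ≤ π / (R + 3))]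
      ring
    rw [Finset.sum_congr rfl fun n _ => h3 n, ← Finset.mul_sum]
    gcongr
    exact hsum'.sum_le_tsum s fun n _ => by positivity

end Fourier

/-- A `C²` function is operator Lipschitz on bounded sets of self-adjoint elements. -/
theorem exists_norm_cfc_sub_le {f : ℝ → ℝ} (hf : ContDiff ℝ 2 f) (A : Type*) [CStarAlgebra A]
    (R : ℝ) : ∃ C : ℝ, 0 ≤ C ∧ ∀ a b : A, IsSelfAdjoint a → IsSelfAdjoint b → ‖a‖ ≤ R → ‖b‖ ≤ R →
      ‖cfc f a - cfc f b‖ ≤ C * ‖a - b‖ := by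
  rcases lt_or_ge R 0 with hR | hR
  · exact ⟨0, le_rfl, fun a _ _ _ ha => absurd (ha.trans_lt hR) (norm_nonneg a).not_gt⟩
  obtain ⟨C, hC⟩ := exists_trig_approx hf hR
  refine ⟨|C|, abs_nonneg C, fun a b ha hb haR hbR => ?_⟩
  refine (norm_cfc_sub_le_of_trig_approx hf.continuous hC ha hb haR hbR).trans ?_
  gcongr
  exact le_abs_self C

namespace GenToda

/-! ### Operators on `ℓ²(ℤ)` and their matrices -/

theorem hasSum_smul_delta (u : L2Z) : HasSum (fun k : ℤ => (u k) • delta k) u := by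
  have h := lp.hasSum_single (E := fun _ : ℤ => ℂ) (p := 2) (by norm_num) u
  refine HasSum.congr_fun (f := fun k : ℤ => (lp.single 2 k (u k) : L2Z)) h fun k => ?_
  have := lp.single_smul (E := fun _ : ℤ => ℂ) 2 k (u k) (1 : ℂ)
  rw [smul_eq_mul, mul_one] at this
  exact this.symm

/-- A bounded operator is determined by its matrix. -/
theorem op_ext {X Y : Op} (h : ∀ j k, entry X j k = entry Y j k) : X = Y := by
  refine ContinuousLinearMap.ext fun u => ?_
  have hk : ∀ k, X (delta k) = Y (delta k) := fun k =>
    L2Z.ext fun j => by rw [← entry_eq, ← entry_eq, h]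
  have e1 := X.hasSum (hasSum_smul_delta u)
  have e2 := Y.hasSum (hasSum_smul_delta u)
  simp only [map_smul, hk] at e1 e2
  exact e1.unique e2

theorem entry_add (X Y : Op) (j k : ℤ) : entry (X + Y) j k = entry X j k + entry Y j k :=
  inner_add_right _ _ _

theorem entry_sub (X Y : Op) (j k : ℤ) : entry (X - Y) j k = entry X j k - entry Y j k :=
  inner_sub_right _ _ _

theorem entry_neg (X : Op) (j k : ℤ) : entry (-X) j k = -entry X j k :=
  inner_neg_right _ _

theorem entry_smul (r : ℝ) (X : Op) (j k : ℤ) : entry (r • X) j k = r * entry X j k := by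
  have : (r • X : Op) = (r : ℂ) • X := (Complex.coe_smul r X).symm
  rw [this]
  exact inner_smul_right _ _ _

theorem entry_star (X : Op) (j k : ℤ) : entry (star X) j k = (starRingEnd ℂ) (entry X k j) := by
  rw [entry, entry, inner_conj_symm]
  exact ContinuousLinearMap.adjoint_inner_right X _ _

theorem entry_sum {ι : Type*} (s : Finset ι) (X : ι → Op) (j k : ℤ) :
    entry (∑ i ∈ s, X i) j k = ∑ i ∈ s, entry (X i) j k := by
  classical
  induction s using Finset.induction_on with
  | empty => simp [entry]
  | insert a s ha ih => rw [Finset.sum_insert ha, Finset.sum_insert ha, entry_add, ih]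

theorem entry_weightedShift (c : ℤ → ℂ) (m : ℤ) (hc : ∃ C : ℝ, ∀ n, ‖c n‖ ≤ C) (j k : ℤ) :
    entry (weightedShift c m hc) j k = if j + m = k then c j else 0 := by
  rw [entry_eq, weightedShift_apply, delta_apply]
  simp

theorem norm_weightedShift_le (c : ℤ → ℂ) (m : ℤ) (hc : ∃ C : ℝ, ∀ n, ‖c n‖ ≤ C) {C : ℝ}
    (hC : ∀ n, ‖c n‖ ≤ C) : ‖weightedShift c m hc‖ ≤ C :=
  ContinuousLinearMap.opNorm_le_bound _ ((norm_nonneg _).trans (hC 0))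
    fun u => norm_mul_shift_le hC m u

/-! ### Tridiagonal operators with real coefficients -/

/-- The Banach space of coefficients of real symmetric tridiagonal operators: pairs `(a, b)` of
bounded real sequences, with no sign condition on `a`. -/
abbrev Coeff : Type := BoundedContinuousFunction ℤ ℝ × BoundedContinuousFunction ℤ ℝ

theorem Coeff.abs_fst_le (x : Coeff) (n : ℤ) : |x.1 n| ≤ ‖x‖ :=
  (x.1.norm_coe_le_norm n).trans (norm_fst_le x)

theorem Coeff.abs_snd_le (x : Coeff) (n : ℤ) : |x.2 n| ≤ ‖x‖ :=
  (x.2.norm_coe_le_norm n).trans (norm_snd_le x)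

theorem Coeff.norm_le {x : Coeff} {C : ℝ} (hC : 0 ≤ C) (h1 : ∀ n, |x.1 n| ≤ C)
    (h2 : ∀ n, |x.2 n| ≤ C) : ‖x‖ ≤ C :=
  max_le ((BoundedContinuousFunction.norm_le hC).2 h1)
    ((BoundedContinuousFunction.norm_le hC).2 h2)

theorem Coeff.norm_fst_coe_le (x : Coeff) (n : ℤ) : ‖(x.1 n : ℂ)‖ ≤ ‖x‖ := by
  simpa using x.abs_fst_le n

theorem Coeff.norm_snd_coe_le (x : Coeff) (n : ℤ) : ‖(x.2 n : ℂ)‖ ≤ ‖x‖ := by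
  simpa using x.abs_snd_le n

/-- The real symmetric tridiagonal operator with given coefficients, as a real-linear map. -/
noncomputable def jacOp : Coeff →L[ℝ] Op :=
  LinearMap.mkContinuous
    { toFun := fun x =>
        weightedShift (fun n => (x.1 n : ℂ)) 1 ⟨_, x.norm_fst_coe_le⟩ +
        weightedShift (fun n => (x.1 (n - 1) : ℂ)) (-1) ⟨_, fun n => x.norm_fst_coe_le (n - 1)⟩ +
        weightedShift (fun n => (x.2 n : ℂ)) 0 ⟨_, x.norm_snd_coe_le⟩
      map_add' := fun x y => op_ext fun j k => by
        simp only [entry_add, entry_weightedShift, Prod.fst_add, Prod.snd_add,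
          BoundedContinuousFunction.coe_add, Pi.add_apply, Complex.ofReal_add]
        split_ifs <;> ring
      map_smul' := fun r x => op_ext fun j k => by
        simp only [entry_add, entry_smul, entry_weightedShift, Prod.smul_fst, Prod.smul_snd,
          BoundedContinuousFunction.coe_smul, smul_eq_mul, Complex.ofReal_mul, RingHom.id_apply]
        split_ifs <;> ring } 3
    (fun x => by
      refine (norm_add₃_le).trans ?_
      have h1 := norm_weightedShift_le _ 1 ⟨_, x.norm_fst_coe_le⟩ x.norm_fst_coe_le
      have h2 := norm_weightedShift_le _ (-1) ⟨_, fun n => x.norm_fst_coe_le (n - 1)⟩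
        (fun n => x.norm_fst_coe_le (n - 1))
      have h3 := norm_weightedShift_le _ 0 ⟨_, x.norm_snd_coe_le⟩ x.norm_snd_coe_le
      linarith)

theorem norm_jacOp_le (x : Coeff) : ‖jacOp x‖ ≤ 3 * ‖x‖ :=
  (jacOp.le_opNorm x).trans (mul_le_mul_of_nonneg_right
    (LinearMap.mkContinuous_norm_le _ (by norm_num) _) (norm_nonneg _))

theorem jacOp_apply (x : Coeff) (u : L2Z) (n : ℤ) :
    jacOp x u n = x.1 n * u (n + 1) + x.1 (n - 1) * u (n - 1) + x.2 n * u n := by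
  have h : jacOp x u n =
      x.1 n * u (n + 1) + x.1 (n - 1) * u (n + -1) + x.2 n * u (n + 0) := rfl
  rw [h, add_zero, ← sub_eq_add_neg]

theorem entry_jacOp (x : Coeff) (j k : ℤ) : entry (jacOp x) j k =
    if k = j + 1 then (x.1 j : ℂ) else if j = k + 1 then (x.1 k : ℂ)
    else if j = k then (x.2 j : ℂ) else 0 := by
  rw [entry_eq, jacOp_apply]
  simp only [delta_apply]
  by_cases h1 : k = j + 1
  · subst h1
    simp [show ¬ (j - 1 = j + 1) by omega]
  by_cases h2 : j = k + 1
  · subst h2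
    simp [show ¬ (k + 1 + 1 = k) by omega, show ¬ (k = k + 1 + 1) by omega]
  by_cases h3 : j = k
  · subst h3
    simp
  · simp [h1, h2, h3, show ¬ (j + 1 = k) by omega, show ¬ (j - 1 = k) by omega]

theorem isSelfAdjoint_jacOp (x : Coeff) : IsSelfAdjoint (jacOp x) := by
  refine op_ext fun j k => ?_
  rw [entry_star, entry_jacOp, entry_jacOp]
  by_cases h1 : k = j + 1
  · rw [if_neg (by omega), if_pos h1, if_pos h1, Complex.conj_ofReal]
  by_cases h2 : j = k + 1
  · rw [if_pos h2, if_neg h1, if_pos h2, Complex.conj_ofReal]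
  by_cases h3 : j = k
  · subst h3
    simp
  · rw [if_neg h1, if_neg h2, if_neg h3, if_neg h2, if_neg h1, if_neg (Ne.symm h3), map_zero]

/-- The coefficients are controlled by the operator norm. -/
theorem norm_le_norm_jacOp (x : Coeff) : ‖x‖ ≤ ‖jacOp x‖ := by
  refine Coeff.norm_le (norm_nonneg _) (fun n => ?_) (fun n => ?_)
  · have := norm_entry_le (jacOp x) n (n + 1)
    rwa [entry_jacOp, if_pos rfl, Complex.norm_real] at this
  · have := norm_entry_le (jacOp x) n n
    rwa [entry_jacOp, if_neg (by omega), if_neg (by omega), if_pos rfl, Complex.norm_real] at this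

theorem matMul_jacOp (A : ℤ → ℤ → ℂ) (x : Coeff) (j k : ℤ) :
    matMul A (entry (jacOp x)) j k =
      A j (k - 1) * x.1 (k - 1) + A j k * x.2 k + A j (k + 1) * x.1 k := by
  rw [matMul, tsum_eq_sum (s := {k - 1, k, k + 1})]
  · rw [Finset.sum_insert (by simp; omega), Finset.sum_insert (by simp), Finset.sum_singleton]
    simp [entry_jacOp, add_assoc]
  · intro m hm
    simp only [Finset.mem_insert, Finset.mem_singleton, not_or] at hm
    rw [entry_jacOp, if_neg (by omega), if_neg (by omega), if_neg (by omega), mul_zero]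

theorem jacOp_matMul (A : ℤ → ℤ → ℂ) (x : Coeff) (j k : ℤ) :
    matMul (entry (jacOp x)) A j k =
      x.1 (j - 1) * A (j - 1) k + x.2 j * A j k + x.1 j * A (j + 1) k := by
  rw [matMul, tsum_eq_sum (s := {j - 1, j, j + 1})]
  · rw [Finset.sum_insert (by simp; omega), Finset.sum_insert (by simp), Finset.sum_singleton]
    simp [entry_jacOp, show ¬ (j - 1 = j + 1) by omega, add_assoc]
  · intro m hm
    simp only [Finset.mem_insert, Finset.mem_singleton, not_or] at hm
    rw [entry_jacOp, if_neg (by omega), if_neg (by omega), if_neg (by omega), zero_mul]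

theorem entry_jacOp_mul (X : Op) (x : Coeff) (j k : ℤ) :
    entry (jacOp x * X) j k = matMul (entry (jacOp x)) (entry X) j k := by
  have h : (jacOp x * X : Op) (delta k) = jacOp x (X (delta k)) := rfl
  rw [entry_eq, h, jacOp_apply, jacOp_matMul]
  simp only [entry_eq]
  ring

theorem entry_mul_jacOp (X : Op) (x : Coeff) (j k : ℤ) :
    entry (X * jacOp x) j k = matMul (entry X) (entry (jacOp x)) j k := by
  have h := entry_star (X * jacOp x) k j
  rw [star_mul, (isSelfAdjoint_jacOp x).star_eq, entry_jacOp_mul, jacOp_matMul] at h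
  have h' := congrArg (starRingEnd ℂ) h
  rw [Complex.conj_conj] at h'
  rw [← h', matMul_jacOp]
  simp only [entry_star, map_add, map_mul, Complex.conj_ofReal, Complex.conj_conj]
  ring

/-! ### The vector field in terms of the coefficients -/

theorem antisymmPart_of_lt (X : Op) {j k : ℤ} (h : j < k) : antisymmPart X j k = entry X j k :=
  if_pos h

theorem antisymmPart_of_gt (X : Op) {j k : ℤ} (h : k < j) : antisymmPart X j k = -entry X j k := by
  rw [antisymmPart, if_neg (by omega), if_pos h]

theorem antisymmPart_self (X : Op) (j : ℤ) : antisymmPart X j j = 0 := by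
  simp [antisymmPart]

theorem abs_re_entry_le (X : Op) (j k : ℤ) : |(entry X j k).re| ≤ ‖X‖ :=
  (Complex.abs_re_le_norm _).trans (norm_entry_le X j k)

theorem abs_laxCoeff_fst_le (x : Coeff) (F : Op) (n : ℤ) :
    |x.1 n * ((entry F (n + 1) (n + 1)).re - (entry F n n).re)| ≤ 4 * (‖x‖ * ‖F‖) := by
  have h := mul_le_mul (x.abs_fst_le n) ((abs_sub _ _).trans (add_le_add
    (abs_re_entry_le F (n + 1) (n + 1)) (abs_re_entry_le F n n))) (abs_nonneg _)
    (norm_nonneg x)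
  rw [abs_mul]
  nlinarith [mul_nonneg (norm_nonneg x) (norm_nonneg F)]

theorem abs_laxCoeff_snd_le (x : Coeff) (F : Op) (n : ℤ) :
    |2 * (x.1 n * (entry F n (n + 1)).re - x.1 (n - 1) * (entry F (n - 1) n).re)| ≤
      4 * (‖x‖ * ‖F‖) := by
  have h1 := mul_le_mul (x.abs_fst_le n) (abs_re_entry_le F n (n + 1)) (abs_nonneg _)
    (norm_nonneg x)
  have h2 := mul_le_mul (x.abs_fst_le (n - 1)) (abs_re_entry_le F (n - 1) n) (abs_nonneg _)
    (norm_nonneg x)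
  rw [← abs_mul] at h1 h2
  have h3 := abs_sub (x.1 n * (entry F n (n + 1)).re) (x.1 (n - 1) * (entry F (n - 1) n).re)
  rw [abs_mul, abs_two]
  linarith

/-- The coefficients of the commutator `[F_a, J]`, where `J` is the tridiagonal operator with
coefficients `x` and `F` is a real symmetric operator commuting with `J`:
`(aₙ (Fₙ₊₁,ₙ₊₁ - Fₙₙ), 2 (aₙ Fₙ,ₙ₊₁ - aₙ₋₁ Fₙ₋₁,ₙ))`. As a formula it makes sense for all `F`, and
is bilinear in `x` and `F`. -/
noncomputable def laxCoeff (x : Coeff) (F : Op) : Coeff :=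
  (BoundedContinuousFunction.ofNormedAddCommGroupDiscrete
    (fun n => x.1 n * ((entry F (n + 1) (n + 1)).re - (entry F n n).re)) (4 * (‖x‖ * ‖F‖))
    (abs_laxCoeff_fst_le x F),
  BoundedContinuousFunction.ofNormedAddCommGroupDiscrete
    (fun n => 2 * (x.1 n * (entry F n (n + 1)).re - x.1 (n - 1) * (entry F (n - 1) n).re))
    (4 * (‖x‖ * ‖F‖))
    (abs_laxCoeff_snd_le x F))

theorem laxCoeff_fst (x : Coeff) (F : Op) (n : ℤ) : (laxCoeff x F).1 n =
    x.1 n * ((entry F (n + 1) (n + 1)).re - (entry F n n).re) := rfl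

theorem laxCoeff_snd (x : Coeff) (F : Op) (n : ℤ) : (laxCoeff x F).2 n =
    2 * (x.1 n * (entry F n (n + 1)).re - x.1 (n - 1) * (entry F (n - 1) n).re) := rfl

theorem norm_laxCoeff_le (x : Coeff) (F : Op) : ‖laxCoeff x F‖ ≤ 4 * (‖x‖ * ‖F‖) :=
  Coeff.norm_le (by positivity) (abs_laxCoeff_fst_le x F) (abs_laxCoeff_snd_le x F)

theorem laxCoeff_sub_left (x y : Coeff) (F : Op) :
    laxCoeff (x - y) F = laxCoeff x F - laxCoeff y F := by
  ext n
  · simp only [laxCoeff_fst, Prod.fst_sub, BoundedContinuousFunction.coe_sub, Pi.sub_apply]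
    ring
  · simp only [laxCoeff_snd, Prod.snd_sub, Prod.fst_sub, BoundedContinuousFunction.coe_sub,
      Pi.sub_apply]
    ring

theorem laxCoeff_sub_right (x : Coeff) (F G : Op) :
    laxCoeff x (F - G) = laxCoeff x F - laxCoeff x G := by
  ext n
  · simp only [laxCoeff_fst, Prod.fst_sub, BoundedContinuousFunction.coe_sub, Pi.sub_apply,
      entry_sub, Complex.sub_re]
    ring
  · simp only [laxCoeff_snd, Prod.snd_sub, BoundedContinuousFunction.coe_sub,
      Pi.sub_apply, entry_sub, Complex.sub_re]
    ring

/-- Because `F` commutes with `J`, the commutator of `J` with the antisymmetric part of `F` is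
tridiagonal, and its coefficients simplify to `laxCoeff`. -/
theorem antisymm_commutator_eq {x : Coeff} {F : Op} (hcomm : F * jacOp x = jacOp x * F)
    (hsymm : IsSelfAdjoint F) (hreal : ∀ j k, (entry F j k).im = 0) (j k : ℤ) :
    matMul (antisymmPart F) (entry (jacOp x)) j k - matMul (entry (jacOp x)) (antisymmPart F) j k =
      entry (jacOp (laxCoeff x F)) j k := by
  have hre : ∀ j k, ((entry F j k).re : ℂ) = entry F j k := fun j k =>
    Complex.ext rfl (hreal j k).symm
  have hsw : ∀ j k, entry F j k = entry F k j := fun j k => by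
    conv_lhs => rw [← hsymm.star_eq, entry_star, ← hre, Complex.conj_ofReal, hre]
  have hc : ∀ j k, entry F j (k - 1) * x.1 (k - 1) + entry F j k * x.2 k +
      entry F j (k + 1) * x.1 k = x.1 (j - 1) * entry F (j - 1) k + x.2 j * entry F j k +
      x.1 j * entry F (j + 1) k := fun j k => by
    rw [← matMul_jacOp, ← jacOp_matMul, ← entry_mul_jacOp, ← entry_jacOp_mul, hcomm]
  rw [matMul_jacOp, jacOp_matMul, entry_jacOp]
  have hcjk := hc j k
  rcases lt_trichotomy (j + 1) k with h | rfl | h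
  · rw [if_neg (by omega), if_neg (by omega), if_neg (by omega)]
    iterate 5 rw [antisymmPart_of_lt F (by omega)]
    rw [hcjk, sub_self]
  · rw [if_pos rfl, laxCoeff_fst]
    push_cast
    rw [hre, hre]
    rw [show j + 1 - 1 = j by ring] at hcjk ⊢
    rw [antisymmPart_self, antisymmPart_self, antisymmPart_of_lt F (show j < j + 1 by omega),
      antisymmPart_of_lt F (show j < j + 1 + 1 by omega),
      antisymmPart_of_lt F (show j - 1 < j + 1 by omega)]
    linear_combination hcjk
  rcases lt_trichotomy (k + 1) j with h' | rfl | h'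
  · rw [if_neg (by omega), if_neg (by omega), if_neg (by omega)]
    iterate 5 rw [antisymmPart_of_gt F (by omega)]
    linear_combination -hcjk
  · rw [if_neg (by omega), if_pos rfl, laxCoeff_fst]
    push_cast
    rw [hre, hre]
    rw [show k + 1 - 1 = k by ring] at hcjk ⊢
    rw [antisymmPart_self, antisymmPart_self, antisymmPart_of_gt F (show k < k + 1 by omega),
      antisymmPart_of_gt F (show k < k + 1 + 1 by omega),
      antisymmPart_of_gt F (show k - 1 < k + 1 by omega)]
    linear_combination -hcjk
  · obtain rfl : j = k := by omega
    rw [if_neg (by omega), if_neg (by omega), if_pos rfl, laxCoeff_snd]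
    push_cast
    rw [hre, hre]
    rw [antisymmPart_self, antisymmPart_of_gt F (show j - 1 < j by omega),
      antisymmPart_of_lt F (show j < j + 1 by omega),
      antisymmPart_of_gt F (show j < j + 1 by omega),
      antisymmPart_of_lt F (show j - 1 < j by omega), hsw j (j - 1), hsw (j + 1) j]
    ring

end GenToda

namespace GenToda

/-! ### Polynomials of tridiagonal operators -/

/-- Weierstrass approximation in the functional calculus. -/
theorem exists_norm_cfc_sub_aeval_le {A : Type*} [CStarAlgebra A] {f : ℝ → ℝ} (hf : Continuous f)
    {a : A} (ha : IsSelfAdjoint a) {ε : ℝ} (hε : 0 < ε) :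
    ∃ p : Polynomial ℝ, ‖cfc f a - Polynomial.aeval a p‖ ≤ ε := by
  obtain ⟨p, hp⟩ := exists_polynomial_near_of_continuousOn (-‖a‖) ‖a‖ f hf.continuousOn ε hε
  refine ⟨p, ?_⟩
  rw [← cfc_polynomial p a, ← cfc_sub f p.eval a]
  refine norm_cfc_le hε.le fun x hx => ?_
  rw [norm_sub_rev]
  exact (hp x (abs_le.1 (norm_le_norm_of_mem_spectrum hx))).le

/-- The matrix of `X` is supported in finitely many diagonals. -/
def IsBanded (X : Op) : Prop := ∃ N : ℤ, ∀ j k, N < |j - k| → entry X j k = 0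

theorem aeval_jacOp_real_banded (x : Coeff) (p : Polynomial ℝ) :
    (∀ j k, (entry (Polynomial.aeval (jacOp x) p) j k).im = 0) ∧
      IsBanded (Polynomial.aeval (jacOp x) p) := by
  have hpow : ∀ n : ℕ, (∀ j k, (entry (jacOp x ^ n) j k).im = 0) ∧ IsBanded (jacOp x ^ n) := by
    intro n
    induction n with
    | zero =>
      have h1 : ∀ j k, entry (1 : Op) j k = if j = k then 1 else 0 := fun j k => by
        rw [entry_eq]
        exact delta_apply k j
      refine ⟨fun j k => ?_, 0, fun j k h => ?_⟩
      · rw [pow_zero, h1]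
        split_ifs <;> simp
      · rw [pow_zero, h1, if_neg]
        rintro rfl
        simp at h
    | succ n ih =>
      obtain ⟨h1, N, hN⟩ := ih
      refine ⟨fun j k => ?_, N + 1, fun j k h => ?_⟩
      · rw [pow_succ, entry_mul_jacOp, matMul_jacOp]
        simp [h1]
      · rw [pow_succ, entry_mul_jacOp, matMul_jacOp, hN _ _, hN _ _, hN _ _]
        · simp
        all_goals
          rw [lt_abs] at h ⊢
          omega
  induction p using Polynomial.induction_on' with
  | add p q hp hq =>
    obtain ⟨hp1, N, hN⟩ := hp
    obtain ⟨hq1, M, hM⟩ := hq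
    rw [map_add]
    refine ⟨fun j k => by simp [entry_add, hp1, hq1], max N M, fun j k h => ?_⟩
    rw [entry_add, hN j k (by omega), hM j k (by omega), add_zero]
  | monomial n r =>
    obtain ⟨h1, N, hN⟩ := hpow n
    rw [Polynomial.aeval_monomial, ← Algebra.smul_def]
    refine ⟨fun j k => by simp [entry_smul, h1], N, fun j k h => ?_⟩
    rw [entry_smul, hN j k h, mul_zero]

theorem im_entry_cfc_jacOp {f : ℝ → ℝ} (hf : Continuous f) (x : Coeff) (j k : ℤ) :
    (entry (cfc f (jacOp x)) j k).im = 0 := by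
  refine abs_nonpos_iff.1 (le_of_forall_pos_le_add fun ε hε => ?_)
  obtain ⟨p, hp⟩ := exists_norm_cfc_sub_aeval_le hf (isSelfAdjoint_jacOp x) hε
  have h1 := (Complex.abs_im_le_norm _).trans
    ((norm_entry_le (cfc f (jacOp x) - Polynomial.aeval (jacOp x) p) j k).trans hp)
  rw [entry_sub, Complex.sub_im, (aeval_jacOp_real_banded x p).1, sub_zero] at h1
  simpa using h1

/-- If `X` is banded and self-adjoint, then its antisymmetric part is the matrix of a bounded
skew-adjoint operator. -/
theorem exists_op_antisymmPart {X : Op} (hX : IsSelfAdjoint X) (hb : IsBanded X) :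
    ∃ B : Op, star B = -B ∧ ∀ j k, entry B j k = antisymmPart X j k := by
  obtain ⟨N, hN⟩ := hb
  have hB : ∀ j k, entry (∑ m ∈ Finset.Icc (-N) N, weightedShift
      (fun n => antisymmPart X n (n + m)) m ⟨‖X‖, fun n => norm_antisymmPart_le X n (n + m)⟩) j k =
      antisymmPart X j k := by
    intro j k
    rw [entry_sum]
    simp only [entry_weightedShift]
    by_cases h : |j - k| ≤ N
    · rw [Finset.sum_eq_single (k - j)]
      · simp
      · intro m _ hm
        exact if_neg (by omega)
      · intro hm
        rw [abs_le] at h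
        exact absurd (Finset.mem_Icc.2 ⟨by omega, by omega⟩) hm
    · rw [Finset.sum_eq_zero]
      · have h0 := hN j k (by omega)
        simp [antisymmPart, h0]
      · intro m hm
        rw [Finset.mem_Icc] at hm
        rw [abs_le] at h
        exact if_neg (by omega)
  refine ⟨_, op_ext fun j k => ?_, hB⟩
  have hsw : entry X j k = (starRingEnd ℂ) (entry X k j) := by
    conv_lhs => rw [← hX.star_eq, entry_star]
  rw [entry_star, entry_neg, hB, hB]
  rcases lt_trichotomy j k with h | rfl | h
  · rw [antisymmPart_of_lt X h, antisymmPart_of_gt X h, hsw, map_neg]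
  · simp [antisymmPart_self]
  · rw [antisymmPart_of_lt X h, antisymmPart_of_gt X h, hsw, neg_neg]

/-- The vector field is a norm limit of commutators `[B, J]` with `B` bounded and skew-adjoint,
although `f(J)_a` itself need not be bounded: replace `f` by polynomials. -/
theorem exists_skew_commutator_approx {f : ℝ → ℝ} (hf : Continuous f) (x : Coeff) {ε : ℝ}
    (hε : 0 < ε) : ∃ B : Op, star B = -B ∧
      ‖jacOp (laxCoeff x (cfc f (jacOp x))) - (B * jacOp x - jacOp x * B)‖ ≤ ε := by
  have hpos : 0 < 12 * (‖x‖ + 1) := by positivity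
  obtain ⟨p, hp⟩ := exists_norm_cfc_sub_aeval_le hf (isSelfAdjoint_jacOp x) (div_pos hε hpos)
  set F : Op := Polynomial.aeval (jacOp x) p
  have hFc : F = cfc p.eval (jacOp x) := (cfc_polynomial p (jacOp x) (isSelfAdjoint_jacOp x)).symm
  have hFs : IsSelfAdjoint F := hFc ▸ cfc_predicate p.eval (jacOp x)
  have hcomm : F * jacOp x = jacOp x * F := by
    have h := congrArg (Polynomial.aeval (jacOp x)) (mul_comm p Polynomial.X)
    rwa [map_mul, map_mul, Polynomial.aeval_X] at h
  obtain ⟨hr, hb⟩ := aeval_jacOp_real_banded x p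
  obtain ⟨B, hB, hBe⟩ := exists_op_antisymmPart hFs hb
  refine ⟨B, hB, ?_⟩
  have hBF : B * jacOp x - jacOp x * B = jacOp (laxCoeff x F) := by
    refine op_ext fun j k => ?_
    have hBe' : entry B = antisymmPart F := funext fun j => funext fun k => hBe j k
    rw [entry_sub, entry_mul_jacOp, entry_jacOp_mul, hBe', antisymm_commutator_eq hcomm hFs hr]
  rw [hBF, ← map_sub, ← laxCoeff_sub_right]
  calc _ ≤ 3 * ‖laxCoeff x (cfc f (jacOp x) - F)‖ := norm_jacOp_le _
    _ ≤ 3 * (4 * (‖x‖ * ‖cfc f (jacOp x) - F‖)) := by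
        gcongr
        exact norm_laxCoeff_le _ _
    _ ≤ 3 * (4 * (‖x‖ * (ε / (12 * (‖x‖ + 1))))) := by gcongr
    _ = ε * (‖x‖ / (‖x‖ + 1)) := by
        field_simp
        ring
    _ ≤ ε * 1 := by
        gcongr
        exact div_le_one_of_le₀ (by linarith) (by positivity)
    _ = ε := mul_one ε

/-! ### Conservation of the norm -/

theorem norm_one_add_smul_skew_sq_le {A : Type*} [CStarAlgebra A] {b : A} (hb : star b = -b)
    (h : ℝ) : ‖1 + h • b‖ ^ 2 ≤ 1 + h ^ 2 * ‖b‖ ^ 2 := by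
  have h1 : star (1 + h • b) * (1 + h • b) = 1 - (h ^ 2) • (b * b) := by
    rw [star_add, star_one, star_smul, hb]
    simp only [star_trivial, add_mul, mul_add, one_mul, mul_one, smul_neg, neg_mul, smul_mul_assoc,
      mul_smul_comm, smul_add, smul_smul, pow_two]
    abel
  have hone : ‖(1 : A)‖ ≤ 1 := by
    rcases subsingleton_or_nontrivial A with _ | _
    · rw [Subsingleton.elim (1 : A) 0, norm_zero]
      exact zero_le_one
    · exact CStarRing.norm_one.le
  rw [pow_two, ← CStarRing.norm_star_mul_self, h1]
  refine (norm_sub_le _ _).trans (add_le_add hone ?_)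
  rw [norm_smul, Real.norm_of_nonneg (sq_nonneg h), pow_two ‖b‖]
  gcongr
  exact norm_mul_le b b

/-- To first order in `h`, `x + h [b, x]` is the conjugate `(1 + h b) x (1 - h b)` of `x` by a
nearly unitary element. -/
theorem norm_add_smul_commutator_le {A : Type*} [CStarAlgebra A] {b : A} (hb : star b = -b)
    (x : A) (h : ℝ) :
    ‖x + h • (b * x - x * b)‖ ≤ ‖x‖ + 2 * h ^ 2 * ‖b‖ ^ 2 * ‖x‖ := by
  have e : x + h • (b * x - x * b) =
      (1 + h • b) * x * (1 + h • (-b)) + (h ^ 2) • (b * x * b) := by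
    simp only [add_mul, mul_add, one_mul, mul_one, smul_neg, mul_neg, smul_mul_assoc,
      mul_smul_comm, smul_add, smul_smul, smul_sub, pow_two]
    abel
  have h1 := norm_one_add_smul_skew_sq_le hb h
  have h2 := norm_one_add_smul_skew_sq_le (b := -b) (by rw [star_neg, hb]) h
  rw [norm_neg] at h2
  have h3 : ‖1 + h • b‖ * ‖1 + h • (-b)‖ ≤ 1 + h ^ 2 * ‖b‖ ^ 2 := by
    nlinarith [sq_nonneg (‖1 + h • b‖ - ‖1 + h • (-b)‖)]
  rw [e]
  calc _ ≤ ‖1 + h • b‖ * ‖x‖ * ‖1 + h • (-b)‖ + h ^ 2 * (‖b‖ * ‖x‖ * ‖b‖) := by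
        refine (norm_add_le _ _).trans (add_le_add ?_ ?_)
        · exact (norm_mul_le _ _).trans (by gcongr; exact norm_mul_le _ _)
        · rw [norm_smul, Real.norm_of_nonneg (sq_nonneg h)]
          gcongr
          exact (norm_mul_le _ _).trans (by gcongr; exact norm_mul_le _ _)
    _ ≤ _ := by nlinarith [mul_le_mul_of_nonneg_right h3 (norm_nonneg x)]

/-- If the velocity of a curve is at each time a norm limit of commutators `[b, x]` with
skew-adjoint `b`, then its norm never exceeds the initial value. -/
theorem norm_le_of_skew_commutator_approx {A : Type*} [CStarAlgebra A] {x x' : ℝ → A}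
    (hx : ∀ t, HasDerivAt x (x' t) t)
    (happ : ∀ t, ∀ ε > 0, ∃ b : A, star b = -b ∧ ‖x' t - (b * x t - x t * b)‖ ≤ ε)
    {t : ℝ} (ht : 0 ≤ t) : ‖x t‖ ≤ ‖x 0‖ := by
  have key : ∀ ε > 0, ‖x t‖ ≤ ‖x 0‖ + ε * t := by
    intro ε hε
    refine image_norm_le_of_liminf_right_slope_norm_lt_deriv_boundary (f := x) (f' := fun _ => 0)
      (a := 0) (b := t) (B := fun s => ‖x 0‖ + ε * s) (B' := fun _ => ε)
      (fun s _ => (hx s).continuousAt.continuousWithinAt) ?_ (by simp) (by fun_prop) ?_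
      (fun _ _ _ => hε) ⟨ht, le_rfl⟩
    · intro s _ r hr
      obtain ⟨b, hb, hbs⟩ := happ s (r / 4) (by positivity)
      have h1 : ∀ᶠ z in nhdsWithin s (Set.Ioi s),
          ‖x z - x s - (z - s) • x' s‖ ≤ r / 4 * ‖z - s‖ :=
        ((hx s).isLittleO.bound (by positivity : 0 < r / 4)).filter_mono nhdsWithin_le_nhds
      have h2 : ∀ᶠ z in nhdsWithin s (Set.Ioi s), 2 * (z - s) * ‖b‖ ^ 2 * ‖x s‖ < r / 4 := by
        have hcont : Continuous fun z : ℝ => 2 * (z - s) * ‖b‖ ^ 2 * ‖x s‖ := by fun_prop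
        exact (hcont.continuousAt.eventually_lt_const (by simp; positivity)).filter_mono
          nhdsWithin_le_nhds
      refine Filter.Eventually.frequently ?_
      filter_upwards [h1, h2, self_mem_nhdsWithin] with z hz1 hz2 hz3
      have hpos : 0 < z - s := sub_pos.2 hz3
      rw [Real.norm_of_nonneg hpos.le] at hz1
      rw [slope_def_field, Function.comp, Function.comp, div_lt_iff₀ hpos]
      have e : x z = (x z - x s - (z - s) • x' s) + (z - s) • (x' s - (b * x s - x s * b)) +
          (x s + (z - s) • (b * x s - x s * b)) := by
        rw [smul_sub (z - s) (x' s)]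
        abel
      have h3 : ‖x z‖ ≤ r / 4 * (z - s) + (z - s) * (r / 4) +
          (‖x s‖ + 2 * (z - s) ^ 2 * ‖b‖ ^ 2 * ‖x s‖) := by
        rw [e]
        refine norm_add₃_le.trans (add_le_add (add_le_add hz1 ?_)
          (norm_add_smul_commutator_le hb (x s) (z - s)))
        rw [norm_smul, Real.norm_of_nonneg hpos.le]
        gcongr
      nlinarith
    · intro s _
      simpa using (((hasDerivAt_id s).const_mul ε).const_add ‖x 0‖).hasDerivWithinAt
  have hlim : Filter.Tendsto (fun ε : ℝ => ‖x 0‖ + ε * t) (nhdsWithin 0 (Set.Ioi 0))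
      (nhds ‖x 0‖) := by
    have : Continuous fun ε : ℝ => ‖x 0‖ + ε * t := by fun_prop
    simpa using (this.tendsto 0).mono_left nhdsWithin_le_nhds
  exact ge_of_tendsto hlim (Filter.eventually_of_mem self_mem_nhdsWithin key)

/-- Both directions of time: the hypotheses are invariant under `t ↦ -t`, `b ↦ -b`. -/
theorem norm_le_of_skew_commutator_approx_of_real {A : Type*} [CStarAlgebra A] {x x' : ℝ → A}
    (hx : ∀ t, HasDerivAt x (x' t) t)
    (happ : ∀ t, ∀ ε > 0, ∃ b : A, star b = -b ∧ ‖x' t - (b * x t - x t * b)‖ ≤ ε)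
    (t : ℝ) : ‖x t‖ ≤ ‖x 0‖ := by
  rcases le_total 0 t with ht | ht
  · exact norm_le_of_skew_commutator_approx hx happ ht
  · have hrev : ∀ s, HasDerivAt (fun s => x (-s)) (-x' (-s)) s := fun s => by
      have h := (hx (-s)).scomp s (hasDerivAt_neg s)
      rw [neg_one_smul] at h
      exact h
    have h := norm_le_of_skew_commutator_approx hrev (fun s ε hε => ?_) (neg_nonneg.2 ht)
    · simpa using h
    · obtain ⟨b, hb, hbs⟩ := happ (-s) ε hε
      refine ⟨-b, by rw [star_neg, hb], ?_⟩
      have e : -x' (-s) - (-b * x (-s) - x (-s) * -b) =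
          -(x' (-s) - (b * x (-s) - x (-s) * b)) := by noncomm_ring
      rw [e, norm_neg]
      exact hbs

end GenToda

/-! ### Ordinary differential equations with globally Lipschitz right-hand side -/

open scoped NNReal

theorem exists_global_solution_of_lipschitz {E : Type*} [NormedAddCommGroup E] [NormedSpace ℝ E]
    [CompleteSpace E] {W : E → E} {K M : ℝ≥0} (hK : LipschitzWith K W) (hM : ∀ x, ‖W x‖ ≤ M)
    (x₀ : E) : ∃ x : ℝ → E, x 0 = x₀ ∧ ∀ t, HasDerivAt x (W (x t)) t := by
  have hex : ∀ n : ℕ, ∃ α : ℝ → E, α 0 = x₀ ∧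
      ∀ t ∈ Set.Ioo (-(n + 1 : ℝ)) (n + 1), HasDerivAt α (W (α t)) t := by
    intro n
    -- the field is bounded by `M` everywhere, so the radius `M * (n + 1)` suffices for time `n + 1`
    have hPL : IsPicardLindelof (fun _ : ℝ => W) (tmin := -(n + 1 : ℝ)) (tmax := n + 1)
        ⟨0, by constructor <;> linarith [n.cast_nonneg (α := ℝ)]⟩ x₀ (M * (n + 1)) 0 M K :=
      { lipschitzOnWith := fun t _ => hK.lipschitzOnWith
        continuousOn := fun x _ => continuousOn_const
        norm_le := fun t _ x _ => hM x
        mul_max_le := by simp }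
    obtain ⟨α, h0, hα⟩ := hPL.exists_eq_forall_mem_Icc_hasDerivWithinAt₀
    exact ⟨α, h0, fun t ht => (hα t (Set.Ioo_subset_Icc_self ht)).hasDerivAt
      (Icc_mem_nhds ht.1 ht.2)⟩
  choose α h0 hα using hex
  have heq : ∀ n m : ℕ, n ≤ m → Set.EqOn (α n) (α m) (Set.Ioo (-(n + 1 : ℝ)) (n + 1)) := by
    intro n m hnm
    have hnm' : (n : ℝ) ≤ m := by exact_mod_cast hnm
    refine ODE_solution_unique_of_mem_Ioo (v := fun _ => W) (s := fun _ => Set.univ) (K := K)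
      (t₀ := 0) (fun _ _ => hK.lipschitzOnWith) ?_ (fun t ht => ⟨hα n t ht, trivial⟩)
      (fun t ht => ⟨hα m t ⟨by linarith [ht.1], by linarith [ht.2]⟩, trivial⟩)
      ((h0 n).trans (h0 m).symm)
    constructor <;> linarith [n.cast_nonneg (α := ℝ)]
  refine ⟨fun t => α ⌈|t|⌉₊ t, h0 _, fun t => ?_⟩
  have hloc : ∀ N : ℕ, ∀ s : ℝ, |s| < N → α ⌈|s|⌉₊ s = α N s := by
    intro N s hs
    refine heq _ _ (Nat.ceil_le.2 hs.le) ?_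
    have := Nat.le_ceil |s|
    have h2 := abs_le.1 this
    constructor <;> linarith
  have hN : |t| < ((⌈|t|⌉₊ + 1 : ℕ) : ℝ) := by
    push_cast
    linarith [Nat.le_ceil |t|]
  have hN' := abs_lt.1 hN
  have hder := hα (⌈|t|⌉₊ + 1) t ⟨by linarith, by linarith⟩
  rw [← hloc _ t hN] at hder
  refine hder.congr_of_eventuallyEq ?_
  filter_upwards [(isOpen_lt continuous_abs continuous_const).mem_nhds hN] with s hs
  exact hloc _ s hs

/-- A cut-off function: `1` on the ball of radius `R`, and `0` outside the ball of radius
`R + 1`. -/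
noncomputable def normCutoff {E : Type*} [NormedAddCommGroup E] (R : ℝ) (x : E) : ℝ :=
  max 0 (min 1 (R + 1 - ‖x‖))

section Cutoff

variable {E : Type*} [NormedAddCommGroup E]

theorem normCutoff_nonneg (R : ℝ) (x : E) : 0 ≤ normCutoff R x := le_max_left _ _

theorem normCutoff_le_one (R : ℝ) (x : E) : normCutoff R x ≤ 1 :=
  max_le zero_le_one (min_le_left _ _)

theorem normCutoff_eq_one {R : ℝ} {x : E} (h : ‖x‖ ≤ R) : normCutoff R x = 1 := by
  rw [normCutoff, min_eq_left (by linarith), max_eq_right zero_le_one]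

theorem normCutoff_eq_zero {R : ℝ} {x : E} (h : R + 1 ≤ ‖x‖) : normCutoff R x = 0 :=
  max_eq_left ((min_le_right _ _).trans (by linarith))

theorem abs_normCutoff_sub_le (R : ℝ) (x y : E) :
    |normCutoff R x - normCutoff R y| ≤ ‖x - y‖ := by
  have h1 : |normCutoff R x - normCutoff R y| ≤ |(R + 1 - ‖x‖) - (R + 1 - ‖y‖)| := by
    refine (abs_max_sub_max_le_max _ _ _ _).trans (max_le (by simp) ?_)
    exact (abs_min_sub_min_le_max _ _ _ _).trans (max_le (by simp) le_rfl)
  refine h1.trans ?_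
  rw [sub_sub_sub_cancel_left, abs_sub_comm]
  exact abs_norm_sub_norm_le x y

variable [NormedSpace ℝ E]

theorem norm_normCutoff_smul_le {V : E → E} {R M : ℝ} (hM0 : 0 ≤ M)
    (hM : ∀ x, ‖x‖ ≤ R + 1 → ‖V x‖ ≤ M) (x : E) : ‖normCutoff R x • V x‖ ≤ M := by
  rcases le_total ‖x‖ (R + 1) with hx | hx
  · rw [norm_smul, Real.norm_of_nonneg (normCutoff_nonneg R x)]
    exact (mul_le_of_le_one_left (norm_nonneg _) (normCutoff_le_one R x)).trans (hM x hx)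
  · rw [normCutoff_eq_zero hx, zero_smul, norm_zero]
    exact hM0

theorem norm_normCutoff_smul_sub_le {V : E → E} {R M L : ℝ} (hM0 : 0 ≤ M) (hL0 : 0 ≤ L)
    (hM : ∀ x, ‖x‖ ≤ R + 1 → ‖V x‖ ≤ M)
    (hL : ∀ x y, ‖x‖ ≤ R + 1 → ‖y‖ ≤ R + 1 → ‖V x - V y‖ ≤ L * ‖x - y‖) (x y : E) :
    ‖normCutoff R x • V x - normCutoff R y • V y‖ ≤ (L + M) * ‖x - y‖ := by
  -- if `y` is outside the larger ball, then the cut-off at `x` is at most `‖x - y‖`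
  have hout : ∀ x y : E, ‖x‖ ≤ R + 1 → R + 1 ≤ ‖y‖ →
      ‖normCutoff R x • V x‖ ≤ (L + M) * ‖x - y‖ := by
    intro x y hx hy
    have h := abs_normCutoff_sub_le R x y
    rw [normCutoff_eq_zero hy, sub_zero] at h
    rw [norm_smul, Real.norm_eq_abs]
    have := mul_le_mul h (hM x hx) (norm_nonneg _) (norm_nonneg _)
    nlinarith [mul_nonneg hL0 (norm_nonneg (x - y))]
  rcases le_total ‖x‖ (R + 1) with hx | hx <;> rcases le_total ‖y‖ (R + 1) with hy | hy
  · have e : normCutoff R x • V x - normCutoff R y • V y =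
        normCutoff R x • (V x - V y) + (normCutoff R x - normCutoff R y) • V y := by
      rw [smul_sub, sub_smul]
      abel
    rw [e, add_mul]
    refine (norm_add_le _ _).trans (add_le_add ?_ ?_)
    · rw [norm_smul, Real.norm_of_nonneg (normCutoff_nonneg R x)]
      exact (mul_le_of_le_one_left (norm_nonneg _) (normCutoff_le_one R x)).trans (hL x y hx hy)
    · rw [norm_smul, Real.norm_eq_abs, mul_comm]
      exact mul_le_mul (hM y hy) (abs_normCutoff_sub_le R x y) (abs_nonneg _) hM0
  · rw [normCutoff_eq_zero hy, zero_smul, sub_zero]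
    exact hout x y hx hy
  · rw [normCutoff_eq_zero hx, zero_smul, zero_sub, norm_neg, norm_sub_rev]
    exact hout y x hy hx
  · rw [normCutoff_eq_zero hx, normCutoff_eq_zero hy]
    simp only [zero_smul, sub_self, norm_zero]
    positivity

end Cutoff

/-- Solutions of a scalar linear equation with bounded coefficient keep their sign. -/
theorem pos_of_hasDerivAt_mul {y c : ℝ → ℝ} {C : ℝ} (hy : ∀ t, HasDerivAt y (y t * c t) t)
    (hc : ∀ t, |c t| ≤ C) (h0 : 0 < y 0) (t : ℝ) : 0 < y t := by
  by_contra! ht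
  have hcont : Continuous y := continuous_iff_continuousAt.2 fun s => (hy s).continuousAt
  obtain ⟨s, hs⟩ := mem_range_of_exists_le_of_exists_ge hcont ⟨t, ht⟩ ⟨0, h0.le⟩
  have hC : 0 ≤ C := (abs_nonneg _).trans (hc 0)
  have hzero : y = fun _ => 0 := by
    refine ODE_solution_unique_univ (v := fun r z => z * c r) (s := fun _ => Set.univ)
      (K := C.toNNReal) (t₀ := s) (fun r => ?_) (fun r => ⟨hy r, trivial⟩)
      (fun r => ⟨by simpa using hasDerivAt_const r (0 : ℝ), trivial⟩) hs
    refine (LipschitzWith.of_dist_le_mul fun z w => ?_).lipschitzOnWith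
    rw [Real.dist_eq, Real.dist_eq, ← sub_mul, abs_mul, Real.coe_toNNReal C hC, mul_comm]
    exact mul_le_mul_of_nonneg_right (hc r) (abs_nonneg _)
  rw [hzero] at h0
  exact lt_irrefl _ h0

namespace GenToda

/-! ### The flow on coefficients -/

/-- The vector field of the generalized Toda flow on the space of coefficients. -/
noncomputable def todaField (f : ℝ → ℝ) (x : Coeff) : Coeff := laxCoeff x (cfc f (jacOp x))

theorem exists_norm_cfc_jacOp_le {f : ℝ → ℝ} (hf : Continuous f) (R : ℝ) :
    ∃ M : ℝ, 0 ≤ M ∧ ∀ x : Coeff, ‖x‖ ≤ R → ‖cfc f (jacOp x)‖ ≤ M := by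
  obtain ⟨M, hM⟩ := (isCompact_Icc (a := -(3 * R)) (b := 3 * R)).exists_bound_of_continuousOn
    hf.continuousOn
  refine ⟨|M|, abs_nonneg M, fun x hx => norm_cfc_le (abs_nonneg M) fun z hz => ?_⟩
  refine (hM z (abs_le.1 ?_)).trans (le_abs_self M)
  exact (norm_le_norm_of_mem_spectrum hz).trans ((norm_jacOp_le x).trans (by linarith))

theorem exists_norm_todaField_le {f : ℝ → ℝ} (hf : Continuous f) (R : ℝ) :
    ∃ M : ℝ, 0 ≤ M ∧ ∀ x : Coeff, ‖x‖ ≤ R → ‖todaField f x‖ ≤ M := by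
  obtain ⟨M, hM0, hM⟩ := exists_norm_cfc_jacOp_le hf R
  refine ⟨4 * (|R| * M), by positivity, fun x hx => (norm_laxCoeff_le _ _).trans ?_⟩
  gcongr
  exacts [hx.trans (le_abs_self R), hM x hx]

/-- The vector field is Lipschitz on bounded sets, because `f` is operator Lipschitz. -/
theorem exists_norm_todaField_sub_le {f : ℝ → ℝ} (hf : ContDiff ℝ 2 f) (R : ℝ) :
    ∃ L : ℝ, 0 ≤ L ∧ ∀ x y : Coeff, ‖x‖ ≤ R → ‖y‖ ≤ R →
      ‖todaField f x - todaField f y‖ ≤ L * ‖x - y‖ := by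
  obtain ⟨M, hM0, hM⟩ := exists_norm_cfc_jacOp_le hf.continuous R
  obtain ⟨C, hC0, hC⟩ := exists_norm_cfc_sub_le hf Op (3 * R)
  refine ⟨4 * M + 12 * |R| * C, by positivity, fun x y hx hy => ?_⟩
  have e : todaField f x - todaField f y = laxCoeff (x - y) (cfc f (jacOp x)) +
      laxCoeff y (cfc f (jacOp x) - cfc f (jacOp y)) := by
    rw [laxCoeff_sub_left, laxCoeff_sub_right, todaField, todaField]
    abel
  have hF : ‖cfc f (jacOp x) - cfc f (jacOp y)‖ ≤ C * (3 * ‖x - y‖) := by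
    refine (hC _ _ (isSelfAdjoint_jacOp x) (isSelfAdjoint_jacOp y)
      ((norm_jacOp_le x).trans (by linarith)) ((norm_jacOp_le y).trans (by linarith))).trans ?_
    rw [← map_sub]
    gcongr
    exact norm_jacOp_le _
  rw [e]
  calc _ ≤ 4 * (‖x - y‖ * ‖cfc f (jacOp x)‖) +
        4 * (‖y‖ * ‖cfc f (jacOp x) - cfc f (jacOp y)‖) :=
        (norm_add_le _ _).trans (add_le_add (norm_laxCoeff_le _ _) (norm_laxCoeff_le _ _))
    _ ≤ 4 * (‖x - y‖ * M) + 4 * (|R| * (C * (3 * ‖x - y‖))) := by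
        gcongr
        exacts [hM x hx, hy.trans (le_abs_self R)]
    _ = _ := by ring

/-- The operator norm never exceeds its value at time `0`, before or after, even when the vector
field is slowed down by a factor `c`. -/
theorem norm_jacOp_le_of_hasDerivAt {f : ℝ → ℝ} (hf : Continuous f) {x : ℝ → Coeff} {c : ℝ → ℝ}
    (hc : ∀ t, 0 ≤ c t ∧ c t ≤ 1) (hx : ∀ t, HasDerivAt x (c t • todaField f (x t)) t) (t : ℝ) :
    ‖jacOp (x t)‖ ≤ ‖jacOp (x 0)‖ := by
  refine norm_le_of_skew_commutator_approx_of_real (x := fun t => jacOp (x t))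
    (fun t => jacOp.hasFDerivAt.comp_hasDerivAt t (hx t)) (fun t ε hε => ?_) t
  obtain ⟨B, hB, hBε⟩ := exists_skew_commutator_approx hf (x t) hε
  refine ⟨c t • B, by rw [star_smul, hB, star_trivial, smul_neg], ?_⟩
  have e : jacOp (c t • todaField f (x t)) - (c t • B * jacOp (x t) - jacOp (x t) * c t • B) =
      c t • (jacOp (laxCoeff (x t) (cfc f (jacOp (x t)))) -
        (B * jacOp (x t) - jacOp (x t) * B)) := by
    rw [map_smul, smul_mul_assoc, mul_smul_comm, smul_sub, smul_sub]
    rfl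
  rw [e, norm_smul, Real.norm_of_nonneg (hc t).1]
  exact (mul_le_of_le_one_left (norm_nonneg _) (hc t).2).trans hBε

theorem norm_jacOp_le_of_hasDerivAt_todaField {f : ℝ → ℝ} (hf : Continuous f) {x : ℝ → Coeff}
    (hx : ∀ t, HasDerivAt x (todaField f (x t)) t) (t : ℝ) :
    ‖jacOp (x t)‖ ≤ ‖jacOp (x 0)‖ :=
  norm_jacOp_le_of_hasDerivAt hf (c := fun _ => 1) (fun _ => ⟨zero_le_one, le_rfl⟩)
    (fun t => by simpa using hx t) t

/-- Cutting off the vector field outside a ball yields a global solution; as the cut-off amounts to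
a time change, the solution never leaves the ball on which the cut-off is `1`. -/
theorem exists_solution_todaField {f : ℝ → ℝ} (hf : ContDiff ℝ 2 f) (x₀ : Coeff) :
    ∃ x : ℝ → Coeff, x 0 = x₀ ∧ ∀ t, HasDerivAt x (todaField f (x t)) t := by
  obtain ⟨M, hM0, hM⟩ := exists_norm_todaField_le hf.continuous (‖jacOp x₀‖ + 1)
  obtain ⟨L, hL0, hL⟩ := exists_norm_todaField_sub_le hf (‖jacOp x₀‖ + 1)
  obtain ⟨x, h0, hx⟩ := exists_global_solution_of_lipschitz
    (W := fun y => normCutoff ‖jacOp x₀‖ y • todaField f y) (K := (L + M).toNNReal)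
    (M := M.toNNReal)
    (LipschitzWith.of_dist_le_mul fun y z => by
      rw [dist_eq_norm, dist_eq_norm, Real.coe_toNNReal _ (by positivity)]
      exact norm_normCutoff_smul_sub_le hM0 hL0 hM hL y z)
    (fun y => by
      rw [Real.coe_toNNReal _ hM0]
      exact norm_normCutoff_smul_le hM0 hM y) x₀
  refine ⟨x, h0, fun t => ?_⟩
  have hle := norm_jacOp_le_of_hasDerivAt hf.continuous
    (c := fun t => normCutoff ‖jacOp x₀‖ (x t))
    (fun t => ⟨normCutoff_nonneg _ _, normCutoff_le_one _ _⟩) hx t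
  rw [h0] at hle
  have h1 := normCutoff_eq_one ((norm_le_norm_jacOp (x t)).trans hle)
  have h2 := hx t
  simp only [h1, one_smul] at h2
  exact h2

theorem solution_todaField_unique {f : ℝ → ℝ} (hf : ContDiff ℝ 2 f) {x y : ℝ → Coeff}
    (hx : ∀ t, HasDerivAt x (todaField f (x t)) t) (hy : ∀ t, HasDerivAt y (todaField f (y t)) t)
    (h0 : x 0 = y 0) : x = y := by
  obtain ⟨L, hL0, hL⟩ := exists_norm_todaField_sub_le hf ‖jacOp (x 0)‖
  refine ODE_solution_unique_univ (v := fun _ => todaField f)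
    (s := fun _ => Metric.closedBall 0 ‖jacOp (x 0)‖) (K := L.toNNReal) (t₀ := 0) (fun _ => ?_)
    (fun t => ⟨hx t, ?_⟩) (fun t => ⟨hy t, ?_⟩) h0
  · refine LipschitzOnWith.of_dist_le_mul fun u hu v hv => ?_
    rw [mem_closedBall_zero_iff] at hu hv
    rw [dist_eq_norm, dist_eq_norm, Real.coe_toNNReal _ hL0]
    exact hL u v hu hv
  · rw [mem_closedBall_zero_iff]
    exact (norm_le_norm_jacOp _).trans (norm_jacOp_le_of_hasDerivAt_todaField hf.continuous hx t)
  · rw [mem_closedBall_zero_iff, h0]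
    exact (norm_le_norm_jacOp _).trans (norm_jacOp_le_of_hasDerivAt_todaField hf.continuous hy t)

theorem solution_todaField_fst_pos {f : ℝ → ℝ} (hf : Continuous f) {x : ℝ → Coeff}
    (hx : ∀ t, HasDerivAt x (todaField f (x t)) t) (n : ℤ) (h0 : 0 < (x 0).1 n) (t : ℝ) :
    0 < (x t).1 n := by
  obtain ⟨M, hM0, hM⟩ := exists_norm_cfc_jacOp_le hf ‖jacOp (x 0)‖
  refine pos_of_hasDerivAt_mul (y := fun s => (x s).1 n) (C := M + M)
    (c := fun s => (entry (cfc f (jacOp (x s))) (n + 1) (n + 1)).re -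
      (entry (cfc f (jacOp (x s))) n n).re) (fun s => ?_) (fun s => ?_) h0 t
  · exact ((BoundedContinuousFunction.evalCLM ℝ n).comp
      (ContinuousLinearMap.fst ℝ _ _)).hasFDerivAt.comp_hasDerivAt s (hx s)
  · have hle := hM (x s) ((norm_le_norm_jacOp _).trans
      (norm_jacOp_le_of_hasDerivAt_todaField hf hx s))
    exact (abs_sub _ _).trans (add_le_add ((abs_re_entry_le _ _ _).trans hle)
      ((abs_re_entry_le _ _ _).trans hle))

/-! ### Jacobi matrices -/

/-- The coefficients of a Jacobi matrix, as an element of the Banach space `Coeff`. -/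
noncomputable def JacobiMatrix.coeff (J : JacobiMatrix) : Coeff :=
  (BoundedContinuousFunction.ofNormedAddCommGroupDiscrete J.a J.a_bdd.choose J.a_bdd.choose_spec,
    BoundedContinuousFunction.ofNormedAddCommGroupDiscrete J.b J.b_bdd.choose J.b_bdd.choose_spec)

theorem JacobiMatrix.op_eq_jacOp (J : JacobiMatrix) : J.op = jacOp J.coeff :=
  op_ext fun j k => by
    rw [JacobiMatrix.entry_op, entry_jacOp]
    rfl

/-- The Jacobi matrix with given coefficients. -/
def JacobiMatrix.ofCoeff (x : Coeff) (hx : ∀ n, 0 < x.1 n) : JacobiMatrix where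
  a := x.1
  b := x.2
  a_pos := hx
  a_bdd := ⟨‖x‖, x.abs_fst_le⟩
  b_bdd := ⟨‖x‖, x.abs_snd_le⟩

theorem JacobiMatrix.coeff_ofCoeff (x : Coeff) (hx : ∀ n, 0 < x.1 n) :
    (JacobiMatrix.ofCoeff x hx).coeff = x := rfl

theorem laxField_eq_jacOp (f : ℝ → ℝ) (hf : Continuous f) (J : JacobiMatrix) :
    laxField f J = jacOp (todaField f J.coeff) := by
  have hM : ∀ j k, laxCommutator f J j k = entry (jacOp (todaField f J.coeff)) j k := by
    intro j k
    rw [laxCommutator, J.op_eq_jacOp]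
    refine antisymm_commutator_eq ?_ (cfc_predicate f _) (im_entry_cfc_jacOp hf _) j k
    have h := cfc_commute_cfc f id (jacOp J.coeff)
    rw [cfc_id ℝ (jacOp J.coeff) (isSelfAdjoint_jacOp _)] at h
    exact h
  refine op_ext fun j k => ?_
  rw [entry_laxField, hM]
  split_ifs with h
  · rfl
  · rw [abs_le] at h
    rw [entry_jacOp, if_neg (by omega), if_neg (by omega), if_neg (by omega)]

theorem hasDerivAt_jacOp_iff {x : ℝ → Coeff} {v : Coeff} {t : ℝ} :
    HasDerivAt (fun s => jacOp (x s)) (jacOp v) t ↔ HasDerivAt x v t := by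
  refine ⟨fun h => ?_, fun h => jacOp.hasFDerivAt.comp_hasDerivAt t h⟩
  rw [hasDerivAt_iff_isLittleO] at h ⊢
  refine Asymptotics.IsBigO.trans_isLittleO (Asymptotics.IsBigO.of_bound 1 ?_) h
  refine Filter.Eventually.of_forall fun s => ?_
  rw [one_mul, ← map_sub, ← map_smul, ← map_sub]
  exact norm_le_norm_jacOp _

theorem isGlobalSolution_iff {f : ℝ → ℝ} (hf : Continuous f) {J : ℝ → JacobiMatrix} :
    IsGlobalSolution f J ↔
      ∀ t, HasDerivAt (fun s => (J s).coeff) (todaField f (J t).coeff) t := by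
  refine forall_congr' fun t => ?_
  rw [laxField_eq_jacOp f hf]
  simp only [JacobiMatrix.op_eq_jacOp]
  exact hasDerivAt_jacOp_iff

end GenToda

theorem theorem2p1 (f : ℝ → ℝ) (hf : ContDiff ℝ 2 f) (J₀ : GenToda.JacobiMatrix) :
    ∃! J : ℝ → GenToda.JacobiMatrix, J 0 = J₀ ∧ GenToda.IsGlobalSolution f J := by
  obtain ⟨x, h0, hx⟩ := GenToda.exists_solution_todaField hf J₀.coeff
  have hpos : ∀ t n, 0 < (x t).1 n := fun t n =>
    GenToda.solution_todaField_fst_pos hf.continuous hx n (by rw [h0]; exact J₀.a_pos n) t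
  refine ⟨fun t => GenToda.JacobiMatrix.ofCoeff (x t) (hpos t), ⟨?_, ?_⟩, ?_⟩
  · refine GenToda.JacobiMatrix.op_injective ?_
    rw [GenToda.JacobiMatrix.op_eq_jacOp, GenToda.JacobiMatrix.op_eq_jacOp,
      GenToda.JacobiMatrix.coeff_ofCoeff, h0]
  · rw [GenToda.isGlobalSolution_iff hf.continuous]
    exact hx
  · rintro K ⟨hK0, hK⟩
    rw [GenToda.isGlobalSolution_iff hf.continuous] at hK
    have h := GenToda.solution_todaField_unique hf hK hx (by rw [hK0, h0])
    funext t
    refine GenToda.JacobiMatrix.op_injective ?_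
    rw [GenToda.JacobiMatrix.op_eq_jacOp, GenToda.JacobiMatrix.op_eq_jacOp,
      GenToda.JacobiMatrix.coeff_ofCoeff, ← h]
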